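/- Let $M\ge 1$ be an integer and $P>0$. For users $k=1,2,\dots$ and transmitters $i=1,2,3$ let $H_{k,i}\in\mathbb{C}^{2M\times M}$ be random channel matrices all of whose entries (over all $k$ and $i$) are i.i.d. circularly symmetric complex Gaussian $\mathcal{CN}(0,1)$. User $k$ uses a postprocessing matrix $F_k\in\mathbb{C}^{M\times 2M}$, $F_kF_k^\dagger=I_M$, which is a (measurable) function of its interfering channels $(H_{k,2},H_{k,3})$ and which minimizes, among all matrices $F$ with $FF^\dagger=I_M$, the rate loss $$\log_2\Big|I_M+\tfrac PM\sum_{i=2}^3FH_{k,i}H_{k,i}^\dagger F^\dagger\Big| .$$ The achievable rate of user $k$ is $$R_k=\log_2\Big|I_M+\tfrac PM F_kH_{k,1}H_{k,1}^\dagger F_k^\dagger\Big(I_M+\tfrac PM\sum_{i=2}^3F_kH_{k,i}H_{k,i}^\dagger F_k^\dagger\Big)^{-1}\Big| .$$ Among the users $1,\dots,K$ one user $k^\star$ is selected, as a (measurable) function of the interfering channels $(H_{k,2},H_{k,3})_{k\le K}$ of these users, by one of the following two opportunistic interference alignment schemes (ties are broken arbitrarily): * OIA1: $k^\star$ minimizes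 $\prod_{m=M+1}^{2M}\big(1+\frac PM\lambda_m(H_{k,2}H_{k,2}^\dagger+H_{k,3}H_{k,3}^\dagger)\big)$ over $k\le K$, where $\lambda_m$ denotes the $m$-th largest eigenvalue; * OIA2: $k^\star$ minimizes the squared chordal distance $M-\mathrm{tr}\big(\tilde H_{k,2}^\dagger\tilde H_{k,3}\tilde H_{k,3}^\dagger\tilde H_{k,2}\big)$ over $k\le K$, where $\tilde H_{k,i}$ is any $2M\times M$ matrix with orthonormal columns and the same column space as $H_{k,i}$ (it exists almost surely). Then for either scheme, with $P$ fixed, the average achievable rate $\mathcal R_{[K]}=\mathbb E[R_{k^\star}]$ of the selected user satisfies $$\lim_{K\to\infty}\mathcal R_{[K]}=\mathbb E\log_2\Big|I_M+\tfrac PM\hat H\hat H^\dagger\Big| ,$$ where $\hat H$ is an $M\times M$ matrix with i.i.d. $\mathcal{CN}(0,1)$ entries; that is, it converges to the ergodic capacity of the interference-free $M\times M$ point-to-point MIMO channel. All these expectations are finite. -/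

import Mathlib

open MeasureTheory ProbabilityTheory Filter Topology
open scoped Matrix

namespace OIA

/-- The law `CN(0, 1)` on `ℂ`: the real and imaginary parts are independent real Gaussians with
mean `0` and variance `1/2`, so that the total variance is `1`. -/
noncomputable def complexGaussian : Measure ℂ :=
  ((gaussianReal 0 (1 / 2)).prod (gaussianReal 0 (1 / 2))).map
    (fun p : ℝ × ℝ => (⟨p.1, p.2⟩ : ℂ))

/-- Channel matrices from a transmitter with `M` antennas to a user with `2 * M` antennas. -/
abbrev Channel (M : ℕ) := Matrix (Fin (2 * M)) (Fin M) ℂ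

/-- Postprocessing matrices. -/
abbrev Post (M : ℕ) := Matrix (Fin M) (Fin (2 * M)) ℂ

/-- The Borel (entrywise product) σ-algebra on matrices. -/
noncomputable instance instMeasurableSpaceMatrix {m n : ℕ} : MeasurableSpace (Matrix (Fin m) (Fin n) ℂ) :=
  (MeasurableSpace.pi : MeasurableSpace (Fin m → Fin n → ℂ))

/-- `H k i` is the random channel matrix from transmitter `i` to user `k` of the first user group
(`i = 0` is the user's own transmitter, `i = 1, 2` are the two interfering ones).  All entries of
all channel matrices are i.i.d. `CN(0, 1)`. -/
structure IsGaussianChannel {Ω : Type*} [MeasurableSpace Ω] {M : ℕ} (μ : Measure Ω)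
    (H : ℕ → Fin 3 → Ω → Channel M) : Prop where
  hasLaw : ∀ (k : ℕ) (i : Fin 3) (r : Fin (2 * M)) (c : Fin M),
    HasLaw (fun ω => H k i ω r c) complexGaussian μ
  indep : iIndepFun
    (fun (j : ℕ × Fin 3 × Fin (2 * M) × Fin M) (ω : Ω) => H j.1 j.2.1 ω j.2.2.1 j.2.2.2) μ

/-- The matrix `I + (P/M) ∑_{i = 2, 3} F Hᵢ Hᵢ† F†`: covariance of noise plus interference after
postprocessing by `F`, where `A` and `B` are the two interfering channels. -/
noncomputable def interferenceCov {M : ℕ} (P : ℝ) (F : Post M) (A B : Channel M) :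
    Matrix (Fin M) (Fin M) ℂ :=
  1 + ((P / M : ℝ) : ℂ) • (F * A * Aᴴ * Fᴴ + F * B * Bᴴ * Fᴴ)

/-- The achievable rate of a user with desired channel `D`, interfering channels `A`, `B` and
postprocessing matrix `F`. -/
noncomputable def rate {M : ℕ} (P : ℝ) (F : Post M) (D A B : Channel M) : ℝ :=
  Real.logb 2 (Matrix.det
    (1 + ((P / M : ℝ) : ℂ) • (F * D * Dᴴ * Fᴴ) * (interferenceCov P F A B)⁻¹)).re

/-- The rate loss term of a user. -/
noncomputable def rateLoss {M : ℕ} (P : ℝ) (F : Post M) (A B : Channel M) : ℝ :=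
  Real.logb 2 (Matrix.det (interferenceCov P F A B)).re

/-- `F k A B` is the postprocessing matrix used by user `k` when its interfering channels are `A`
and `B`: it has orthonormal rows and minimizes the rate loss term among all such matrices. -/
structure IsOIAPostprocessing {M : ℕ} (P : ℝ)
    (F : ℕ → Channel M → Channel M → Post M) : Prop where
  measurable : ∀ k, Measurable (fun p : Channel M × Channel M => F k p.1 p.2)
  semiUnitary : ∀ k A B, F k A B * (F k A B)ᴴ = 1
  minimal : ∀ k A B (F' : Post M), F' * F'ᴴ = 1 → rateLoss P (F k A B) A B ≤ rateLoss P F' A B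

theorem isHermitian_interference {M : ℕ} (A B : Channel M) : (A * Aᴴ + B * Bᴴ).IsHermitian :=
  (Matrix.isHermitian_mul_conjTranspose_self A).add (Matrix.isHermitian_mul_conjTranspose_self B)

/-- The value fed back in the first scheme, `∏_{m = M+1}^{2M} (1 + (P/M) λₘ(A A† + B B†))`, where
`λₘ` is the `m`-th largest eigenvalue (`eigenvalues₀` lists them in decreasing order, starting
from the index `0`). -/
noncomputable def feedback1 {M : ℕ} (P : ℝ) (A B : Channel M) : ℝ :=
  ∏ m : Fin (Fintype.card (Fin (2 * M))),
    if M ≤ (m : ℕ) then 1 + P / M * (isHermitian_interference A B).eigenvalues₀ m else 1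

/-- `A` is a generator matrix of the `M`-dimensional subspace spanned by the columns of `H`. -/
def IsGenerator {M : ℕ} (A H : Channel M) : Prop :=
  Aᴴ * A = 1 ∧ LinearMap.range A.mulVecLin = LinearMap.range H.mulVecLin

/-- The squared chordal distance of the subspaces with generator matrices `A` and `B`. -/
noncomputable def chordalDistSq {M : ℕ} (A B : Channel M) : ℝ :=
  M - (Matrix.trace (Aᴴ * B * Bᴴ * A)).re

/-- A user selection rule: with `K + 1` users, the selected user as a function of the pairs of
interfering channels of all users. -/
abbrev Selection (M : ℕ) := (K : ℕ) → (Fin (K + 1) → Channel M × Channel M) → Fin (K + 1)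

/-- First scheme: the selected user has the smallest fed back eigenvalue product. -/
structure IsOIA1Selection {M : ℕ} (P : ℝ) (sel : Selection M) : Prop where
  measurable : ∀ K, Measurable (sel K)
  minimal : ∀ K (G : Fin (K + 1) → Channel M × Channel M) (k : Fin (K + 1)),
    feedback1 P (G (sel K G)).1 (G (sel K G)).2 ≤ feedback1 P (G k).1 (G k).2

/-- Second scheme: the selected user has the smallest chordal distance between the subspaces
spanned by its two interfering channels, computed from arbitrary generator matrices.  Generator
matrices with `M` columns exist exactly when the channel matrices have full rank `M`. -/
structure IsOIA2Selection {M : ℕ} (sel : Selection M) : Prop where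
  measurable : ∀ K, Measurable (sel K)
  minimal : ∀ K (G T : Fin (K + 1) → Channel M × Channel M),
    (∀ k, IsGenerator (T k).1 (G k).1 ∧ IsGenerator (T k).2 (G k).2) →
    ∀ k : Fin (K + 1),
      chordalDistSq (T (sel K G)).1 (T (sel K G)).2 ≤ chordalDistSq (T k).1 (T k).2

/-- The achievable rate of the selected user among the users `0, …, K`. -/
noncomputable def selectedRate {Ω : Type*} {M : ℕ} (P : ℝ) (H : ℕ → Fin 3 → Ω → Channel M)
    (F : ℕ → Channel M → Channel M → Post M) (sel : Selection M) (K : ℕ) (ω : Ω) : ℝ :=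
  let k : ℕ := sel K (fun j => (H j 1 ω, H j 2 ω))
  rate P (F k (H k 1 ω) (H k 2 ω)) (H k 0 ω) (H k 1 ω) (H k 2 ω)

/-- The law of an `M × M` matrix with i.i.d. `CN(0, 1)` entries. -/
noncomputable def gaussianMatrix (M : ℕ) : Measure (Fin M → Fin M → ℂ) :=
  Measure.pi fun _ => Measure.pi fun _ => complexGaussian

/-- The rate `log₂ |I + (P/M) Ĥ Ĥ†|` of the point-to-point channel `Ĥ`. -/
noncomputable def pointToPointRate {M : ℕ} (P : ℝ) (H : Matrix (Fin M) (Fin M) ℂ) : ℝ :=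
  Real.logb 2 (Matrix.det (1 + ((P / M : ℝ) : ℂ) • (H * Hᴴ))).re

/-- The ergodic capacity of the interference-free `M × M` point-to-point channel. -/
noncomputable def ergodicCapacity (M : ℕ) (P : ℝ) : ℝ :=
  ∫ H, pointToPointRate P (Matrix.of H) ∂(gaussianMatrix M)

end OIA

/-!
For every channel realization the rate of a user is the difference of the log-determinants of the
total and of the interfering covariance. It is therefore at most the point-to-point rate of the
effective channel `F D`, and falls short of it by at most the rate loss. The optimal loss is at most
the logarithm of the eigenvalue product fed back in the first scheme, by projecting onto the
eigenvectors of the `M` smallest eigenvalues of the interference.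

Fix a matrix `E` with orthonormal columns. As the number of users grows, with high probability some
user has both interfering channels at distance at most `x⁻²` from `E`, while no channel is larger
than `x`, for a scale `x → ∞`. That user makes both the eigenvalue product close to `1` and the
chordal distance close to `0`, on a scale that the size of the selected channels cannot compensate.
Hence the eigenvalue product of the selected user tends to `1` in probability under either scheme,
and its rate loss to `0`.

Selection and postprocessing depend on the interfering channels only. By unitary invariance of the
Gaussian law, the effective channel of the selected user is a square Gaussian matrix independent of
them, so the mean rate is squeezed to the ergodic capacity.
-/

namespace OIA

open scoped ComplexOrder Matrix.Norms.Frobenius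

section LogDet

variable {n : Type*} [Fintype n] [DecidableEq n]

/-- The rate `log₂ |I + S|` in bits. For a positive semidefinite `S` the determinant is real and at
least `1`, so that taking its real part loses nothing. -/
noncomputable def logDet (S : Matrix n n ℂ) : ℝ :=
  Real.logb 2 (1 + S).det.re

variable {S X : Matrix n n ℂ}

omit [Fintype n] in
theorem posDef_one_add (hS : S.PosSemidef) : (1 + S).PosDef :=
  Matrix.PosDef.one.add_posSemidef hS

theorem isUnit_det_one_add (hS : S.PosSemidef) : IsUnit (1 + S).det :=
  (posDef_one_add hS).det_pos.ne'.isUnit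

theorem exists_unitary_conj_eq_diagonal (hS : S.IsHermitian) :
    ∃ U : Matrix n n ℂ, Uᴴ * U = 1 ∧
      Uᴴ * S * U = Matrix.diagonal (fun i => (hS.eigenvalues i : ℂ)) := by
  refine ⟨hS.eigenvectorUnitary, Unitary.coe_star_mul_self hS.eigenvectorUnitary, ?_⟩
  have h := hS.conjStarAlgAut_star_eigenvectorUnitary
  rwa [Unitary.conjStarAlgAut_star_apply] at h

theorem det_one_add_eq_prod (hS : S.IsHermitian) :
    (1 + S).det = ((∏ i, (1 + hS.eigenvalues i) : ℝ) : ℂ) := by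
  obtain ⟨U, hU, hdiag⟩ := exists_unitary_conj_eq_diagonal hS
  have hconj : Uᴴ * (1 + S) * U = Matrix.diagonal (fun i => ((1 + hS.eigenvalues i : ℝ) : ℂ)) := by
    rw [mul_add, add_mul, hdiag, mul_one, hU, ← Matrix.diagonal_one, Matrix.diagonal_add]
    simp only [Complex.ofReal_add, Complex.ofReal_one]
  have hdet : Uᴴ.det * U.det = 1 := by rw [← Matrix.det_mul, hU, Matrix.det_one]
  calc (1 + S).det = (Uᴴ * (1 + S) * U).det := by
        rw [Matrix.det_mul, Matrix.det_mul, mul_right_comm, hdet, one_mul]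
    _ = _ := by rw [hconj, Matrix.det_diagonal, Complex.ofReal_prod]

theorem one_le_det_one_add (hS : S.PosSemidef) : 1 ≤ (1 + S).det.re := by
  rw [det_one_add_eq_prod hS.1, Complex.ofReal_re]
  exact Finset.one_le_prod fun i _ => le_add_of_nonneg_right (hS.eigenvalues_nonneg i)

theorem det_one_add_le_exp_trace (hS : S.PosSemidef) :
    (1 + S).det.re ≤ Real.exp S.trace.re := by
  have htrace : S.trace.re = ∑ i, hS.1.eigenvalues i := by
    rw [hS.1.trace_eq_sum_eigenvalues, Complex.re_sum]
    rfl
  rw [det_one_add_eq_prod hS.1, Complex.ofReal_re, htrace, Real.exp_sum]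
  refine Finset.prod_le_prod (fun i _ => ?_) fun i _ => ?_
  · exact add_nonneg zero_le_one (hS.eigenvalues_nonneg i)
  · exact (add_comm _ _).trans_le (Real.add_one_le_exp _)

theorem posSemidef_one_sub_inv (hS : S.PosSemidef) : (1 - (1 + S)⁻¹).PosSemidef := by
  have hpos := posDef_one_add hS
  have hunit := isUnit_det_one_add hS
  have hfactor : 1 - (1 + S)⁻¹ = (1 + S)⁻¹ * (S + S * Sᴴ) * ((1 + S)⁻¹)ᴴ := by
    have hsq : S + S * S = (1 + S) * (1 + S) - (1 + S) := by noncomm_ring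
    rw [hpos.inv.1.eq, hS.1.eq, hsq, mul_sub, sub_mul, Matrix.nonsing_inv_mul _ hunit, ← mul_assoc,
      Matrix.nonsing_inv_mul _ hunit, one_mul, one_mul, Matrix.mul_nonsing_inv _ hunit]
  rw [hfactor]
  exact (hS.add (Matrix.posSemidef_self_mul_conjTranspose S)).mul_mul_conjTranspose_same _

open scoped MatrixOrder Matrix.Norms.L2Operator in
omit [DecidableEq n] in
theorem exists_eq_mul_conjTranspose (hX : X.PosSemidef) : ∃ Y : Matrix n n ℂ, X = Y * Yᴴ := by
  classical
  obtain ⟨Y, hY⟩ := CStarAlgebra.nonneg_iff_eq_mul_star_self.1 hX.nonneg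
  exact ⟨Y, hY⟩

theorem det_one_add_add_mul_conjTranspose (hS : S.PosSemidef) (Y : Matrix n n ℂ) :
    (1 + S + Y * Yᴴ).det.re = (1 + S).det.re * (1 + Yᴴ * (1 + S)⁻¹ * Y).det.re := by
  rw [Matrix.det_add_mul _ _ (isUnit_det_one_add hS), det_one_add_eq_prod hS.1,
    Complex.re_ofReal_mul, Complex.ofReal_re]

theorem det_one_add_le_det_one_add_add (hS : S.PosSemidef) (hX : X.PosSemidef) :
    (1 + S).det.re ≤ (1 + S + X).det.re := by
  obtain ⟨Y, rfl⟩ := exists_eq_mul_conjTranspose hX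
  rw [det_one_add_add_mul_conjTranspose hS]
  refine le_mul_of_one_le_right (zero_le_one.trans (one_le_det_one_add hS)) ?_
  exact one_le_det_one_add ((posDef_one_add hS).inv.posSemidef.conjTranspose_mul_mul_same Y)

theorem det_one_add_add_le (hS : S.PosSemidef) (hX : X.PosSemidef) :
    (1 + S + X).det.re ≤ (1 + S).det.re * (1 + X).det.re := by
  obtain ⟨Y, rfl⟩ := exists_eq_mul_conjTranspose hX
  rw [det_one_add_add_mul_conjTranspose hS]
  refine mul_le_mul_of_nonneg_left ?_ (zero_le_one.trans (one_le_det_one_add hS))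
  calc (1 + Yᴴ * (1 + S)⁻¹ * Y).det.re
      ≤ (1 + Yᴴ * (1 + S)⁻¹ * Y + Yᴴ * (1 - (1 + S)⁻¹) * Y).det.re :=
        det_one_add_le_det_one_add_add
          ((posDef_one_add hS).inv.posSemidef.conjTranspose_mul_mul_same Y)
          ((posSemidef_one_sub_inv hS).conjTranspose_mul_mul_same Y)
    _ = (1 + Y * Yᴴ).det.re := by
        rw [Matrix.det_one_add_mul_comm Y, add_assoc, ← Matrix.add_mul, ← Matrix.mul_add,
          add_sub_cancel, Matrix.mul_one]

theorem logDet_nonneg (hS : S.PosSemidef) : 0 ≤ logDet S :=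
  Real.logb_nonneg one_lt_two (one_le_det_one_add hS)

theorem logDet_le_trace_div (hS : S.PosSemidef) : logDet S ≤ S.trace.re / Real.log 2 := by
  have hdet := zero_lt_one.trans_le (one_le_det_one_add hS)
  rw [logDet, Real.logb]
  gcongr
  exact (Real.log_le_iff_le_exp hdet).2 (det_one_add_le_exp_trace hS)

theorem logDet_le_logDet_add (hS : S.PosSemidef) (hX : X.PosSemidef) :
    logDet S ≤ logDet (S + X) := by
  rw [logDet, logDet, ← add_assoc]
  exact Real.logb_le_logb_of_le one_lt_two (zero_lt_one.trans_le (one_le_det_one_add hS))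
    (det_one_add_le_det_one_add_add hS hX)

theorem logDet_add_le (hS : S.PosSemidef) (hX : X.PosSemidef) :
    logDet (S + X) ≤ logDet S + logDet X := by
  have hdetS := zero_lt_one.trans_le (one_le_det_one_add hS)
  have hdetX := zero_lt_one.trans_le (one_le_det_one_add hX)
  have hdet := zero_lt_one.trans_le (one_le_det_one_add (hS.add hX))
  rw [logDet, logDet, logDet, ← Real.logb_mul hdetS.ne' hdetX.ne']
  refine Real.logb_le_logb_of_le one_lt_two hdet ?_
  rw [← add_assoc]
  exact det_one_add_add_le hS hX

end LogDet

section Rates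

variable {M : ℕ} {P : ℝ}

/-- The received covariance `(P/M) X X†` of the signal that arrives through the channel `X`. -/
noncomputable def signalCov {m : Type*} (M : ℕ) (P : ℝ) (X : Matrix m (Fin M) ℂ) : Matrix m m ℂ :=
  ((P / M : ℝ) : ℂ) • (X * Xᴴ)

theorem posSemidef_signalCov {m : Type*} [Finite m] (hP : 0 ≤ P) (X : Matrix m (Fin M) ℂ) :
    (signalCov M P X).PosSemidef :=
  (Matrix.posSemidef_self_mul_conjTranspose X).smul
    (Complex.zero_le_real.2 (div_nonneg hP (Nat.cast_nonneg M)))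

/-- The rate of the signal `X` in the presence of Gaussian noise of covariance `I + S`, as a
difference of two logarithmic determinants. -/
noncomputable def effectiveRate (P : ℝ) (S X : Matrix (Fin M) (Fin M) ℂ) : ℝ :=
  logDet (S + signalCov M P X) - logDet S

theorem pointToPointRate_nonneg (hP : 0 ≤ P) (X : Matrix (Fin M) (Fin M) ℂ) :
    0 ≤ pointToPointRate P X :=
  logDet_nonneg (posSemidef_signalCov hP X)

theorem effectiveRate_nonneg (hP : 0 ≤ P) {S : Matrix (Fin M) (Fin M) ℂ} (hS : S.PosSemidef)
    (X : Matrix (Fin M) (Fin M) ℂ) : 0 ≤ effectiveRate P S X :=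
  sub_nonneg.2 (logDet_le_logDet_add hS (posSemidef_signalCov hP X))

theorem effectiveRate_le_pointToPointRate (hP : 0 ≤ P) {S : Matrix (Fin M) (Fin M) ℂ}
    (hS : S.PosSemidef) (X : Matrix (Fin M) (Fin M) ℂ) :
    effectiveRate P S X ≤ pointToPointRate P X :=
  sub_le_iff_le_add'.2 (logDet_add_le hS (posSemidef_signalCov hP X))

theorem pointToPointRate_sub_logDet_le (hP : 0 ≤ P) {S : Matrix (Fin M) (Fin M) ℂ}
    (hS : S.PosSemidef) (X : Matrix (Fin M) (Fin M) ℂ) :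
    pointToPointRate P X - logDet S ≤ effectiveRate P S X := by
  refine sub_le_sub_right ?_ _
  rw [add_comm S]
  exact logDet_le_logDet_add (posSemidef_signalCov hP X) hS

/-- The covariance `(P/M) ∑ F Hᵢ Hᵢ† F†` of the interference after postprocessing by `F`. -/
noncomputable def interference (P : ℝ) (F : Post M) (A B : Channel M) : Matrix (Fin M) (Fin M) ℂ :=
  signalCov M P (F * A) + signalCov M P (F * B)

theorem posSemidef_interference (hP : 0 ≤ P) (F : Post M) (A B : Channel M) :
    (interference P F A B).PosSemidef :=
  (posSemidef_signalCov hP _).add (posSemidef_signalCov hP _)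

theorem interferenceCov_eq (F : Post M) (A B : Channel M) :
    interferenceCov P F A B = 1 + interference P F A B := by
  simp only [interferenceCov, interference, signalCov, Matrix.conjTranspose_mul, Matrix.mul_assoc,
    smul_add]

theorem rateLoss_eq (F : Post M) (A B : Channel M) :
    rateLoss P F A B = logDet (interference P F A B) := by
  rw [rateLoss, interferenceCov_eq, logDet]

theorem rate_eq_effectiveRate (hP : 0 ≤ P) (F : Post M) (D A B : Channel M) :
    rate P F D A B = effectiveRate P (interference P F A B) (F * D) := by
  have hS := posSemidef_interference hP F A B
  have hX := posSemidef_signalCov hP (F * D)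
  have hdetS := one_le_det_one_add hS
  have hdet := one_le_det_one_add (hS.add hX)
  have hunit := isUnit_det_one_add hS
  set S := interference P F A B
  set X := signalCov M P (F * D) with hXdef
  have hfactor : (1 + X * (1 + S)⁻¹) * (1 + S) = 1 + (S + X) := by
    rw [add_mul, one_mul, mul_assoc, Matrix.nonsing_inv_mul _ hunit, mul_one, add_assoc]
  have hprod : (1 + S).det.re * (1 + X * (1 + S)⁻¹).det.re = (1 + (S + X)).det.re := by
    rw [← hfactor, Matrix.det_mul, mul_comm (Matrix.det _), det_one_add_eq_prod hS.1,
      Complex.re_ofReal_mul, Complex.ofReal_re]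
  have hne : (1 + X * (1 + S)⁻¹).det.re ≠ 0 :=
    right_ne_zero_of_mul (hprod.trans_ne (zero_lt_one.trans_le hdet).ne')
  have hXeq : X = ((P / M : ℝ) : ℂ) • (F * D * Dᴴ * Fᴴ) := by
    rw [hXdef, signalCov, Matrix.conjTranspose_mul, ← Matrix.mul_assoc]
  rw [rate, interferenceCov_eq, ← hXeq, effectiveRate, logDet, logDet, ← hprod,
    Real.logb_mul (zero_lt_one.trans_le hdetS).ne' hne, add_sub_cancel_left]

end Rates

section Frobenius

variable {m n : Type*} [Fintype m] [Fintype n]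

theorem frobenius_norm_sq (X : Matrix m n ℂ) : ‖X‖ ^ 2 = ∑ i, ∑ j, ‖X i j‖ ^ 2 := by
  rw [Matrix.frobenius_norm_def, ← Real.rpow_mul_natCast (by positivity)]
  norm_num

theorem frobenius_norm_sq_eq_trace (X : Matrix m n ℂ) : ‖X‖ ^ 2 = (Xᴴ * X).trace.re := by
  rw [frobenius_norm_sq, Finset.sum_comm]
  simp only [Matrix.trace, Matrix.diag_apply, Matrix.mul_apply, Matrix.conjTranspose_apply,
    RCLike.star_def, ← Complex.normSq_eq_conj_mul_self, Complex.normSq_eq_norm_sq,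
    Complex.re_sum, Complex.ofReal_re]

theorem norm_toLp_mulVec_le (X : Matrix m n ℂ) (v : n → ℂ) :
    ‖WithLp.toLp 2 (X *ᵥ v)‖ ≤ ‖X‖ * ‖WithLp.toLp 2 v‖ := by
  rw [← Matrix.frobenius_norm_replicateCol (ι := Unit),
    ← Matrix.frobenius_norm_replicateCol (ι := Unit), Matrix.replicateCol_mulVec]
  exact Matrix.frobenius_norm_mul _ _

theorem star_dotProduct_self_re (v : n → ℂ) : (star v ⬝ᵥ v).re = ‖WithLp.toLp 2 v‖ ^ 2 := by
  simp [EuclideanSpace.norm_sq_eq, dotProduct, Complex.conj_mul', ← Complex.ofReal_pow]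

theorem pointToPointRate_le {M : ℕ} {P : ℝ} (hP : 0 ≤ P) (X : Matrix (Fin M) (Fin M) ℂ) :
    pointToPointRate P X ≤ P / M * ‖X‖ ^ 2 / Real.log 2 := by
  have h := logDet_le_trace_div (posSemidef_signalCov hP X)
  rwa [signalCov, Matrix.trace_smul, Matrix.trace_mul_comm, smul_eq_mul, Complex.re_ofReal_mul,
    ← frobenius_norm_sq_eq_trace] at h

end Frobenius

section CourantFischer

theorem exists_ne_zero_mulVec_eq_zero {m n : Type*} [Fintype m] [Fintype n]
    (h : Fintype.card m < Fintype.card n) (A : Matrix m n ℂ) :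
    ∃ v : n → ℂ, v ≠ 0 ∧ A *ᵥ v = 0 := by
  have hker : LinearMap.ker A.mulVecLin ≠ ⊥ :=
    LinearMap.ker_ne_bot_of_finrank_lt (by simpa only [Module.finrank_fintype_fun_eq_card] using h)
  obtain ⟨v, hv, hv0⟩ := Submodule.exists_mem_ne_zero_of_ne_bot hker
  exact ⟨v, hv0, hv⟩

variable {n : Type*} [Fintype n] [DecidableEq n] {S : Matrix n n ℂ}

theorem exists_frame_diagonal_eigenvalues₀ {r : Type*} [DecidableEq r] (hS : S.IsHermitian)
    {ι : r → Fin (Fintype.card n)} (hι : Function.Injective ι) :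
    ∃ V : Matrix n r ℂ, Vᴴ * V = 1 ∧
      Vᴴ * S * V = Matrix.diagonal (fun j => (hS.eigenvalues₀ (ι j) : ℂ)) := by
  obtain ⟨U, hU, hdiag⟩ := exists_unitary_conj_eq_diagonal hS
  let κ : r → n := Fintype.equivOfCardEq (Fintype.card_fin _) ∘ ι
  have hκ : Function.Injective κ := (Equiv.injective _).comp hι
  have hcompress (X : Matrix n n ℂ) :
      (U.submatrix id κ)ᴴ * X * U.submatrix id κ = (Uᴴ * X * U).submatrix κ κ := by
    rw [Matrix.conjTranspose_submatrix, Matrix.submatrix_mul _ _ κ id κ Function.bijective_id,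
      Matrix.submatrix_mul _ _ κ id id Function.bijective_id, Matrix.submatrix_id_id]
  refine ⟨U.submatrix id κ, ?_, ?_⟩
  · have h := hcompress 1
    rwa [Matrix.mul_one, Matrix.mul_one, hU, Matrix.submatrix_one _ hκ] at h
  · rw [hcompress, hdiag, Matrix.submatrix_diagonal _ _ hκ]
    congr 1
    funext j
    simp only [Function.comp_apply, Matrix.IsHermitian.eigenvalues, κ, Equiv.symm_apply_apply]

theorem star_dotProduct_diagonal_mulVec_re (d : n → ℝ) (v : n → ℂ) :
    (star v ⬝ᵥ (Matrix.diagonal (fun i => (d i : ℂ)) *ᵥ v)).re = ∑ i, d i * ‖v i‖ ^ 2 := by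
  simp only [dotProduct, Matrix.mulVec_diagonal, Pi.star_apply, RCLike.star_def, Complex.re_sum]
  refine Finset.sum_congr rfl fun i _ => ?_
  rw [mul_left_comm, Complex.conj_mul', Complex.re_ofReal_mul]
  norm_cast

/- The span of the eigenvectors of the `k + 1` largest eigenvalues meets the kernel of `C`. -/
theorem eigenvalues₀_le_of_forall_mulVec_eq_zero {m : Type*} [Fintype m] (hS : S.IsHermitian)
    (C : Matrix m n ℂ) (k : Fin (Fintype.card n)) (hk : Fintype.card m ≤ k) {s : ℝ}
    (hs : ∀ x, C *ᵥ x = 0 → (star x ⬝ᵥ (S *ᵥ x)).re ≤ s * ‖WithLp.toLp 2 x‖ ^ 2) :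
    hS.eigenvalues₀ k ≤ s := by
  obtain ⟨V, hV, hdiag⟩ := exists_frame_diagonal_eigenvalues₀ hS
    (Fin.castLE_injective (Nat.succ_le_of_lt k.isLt))
  obtain ⟨a, ha, hCa⟩ := exists_ne_zero_mulVec_eq_zero
    (by rw [Fintype.card_fin]; omega) (C * V)
  have hnorm : ‖WithLp.toLp 2 (V *ᵥ a)‖ ^ 2 = ‖WithLp.toLp 2 a‖ ^ 2 := by
    rw [← star_dotProduct_self_re, Matrix.star_mulVec, ← Matrix.dotProduct_mulVec,
      Matrix.mulVec_mulVec, hV, Matrix.one_mulVec, star_dotProduct_self_re]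
  have hform : (star (V *ᵥ a) ⬝ᵥ (S *ᵥ (V *ᵥ a))).re =
      ∑ i, hS.eigenvalues₀ (Fin.castLE k.isLt i) * ‖a i‖ ^ 2 := by
    rw [Matrix.star_mulVec, ← Matrix.dotProduct_mulVec, Matrix.mulVec_mulVec,
      Matrix.mulVec_mulVec, hdiag, star_dotProduct_diagonal_mulVec_re]
  have hbound := hs (V *ᵥ a) (by rw [Matrix.mulVec_mulVec, hCa])
  have hpos : 0 < ‖WithLp.toLp 2 a‖ ^ 2 := by
    have : WithLp.toLp 2 a ≠ 0 := by simpa using ha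
    positivity
  refine le_of_mul_le_mul_right ?_ hpos
  calc hS.eigenvalues₀ k * ‖WithLp.toLp 2 a‖ ^ 2
      ≤ ∑ i, hS.eigenvalues₀ (Fin.castLE k.isLt i) * ‖a i‖ ^ 2 := by
        rw [EuclideanSpace.norm_sq_eq, Finset.mul_sum]
        refine Finset.sum_le_sum fun i _ => mul_le_mul_of_nonneg_right ?_ (sq_nonneg _)
        exact hS.eigenvalues₀_antitone (Fin.le_def.2 (Nat.le_of_lt_succ i.isLt))
    _ ≤ s * ‖WithLp.toLp 2 a‖ ^ 2 := by rw [← hform, ← hnorm]; exact hbound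

end CourantFischer

section Feedback

variable {M : ℕ} {P : ℝ} (A B : Channel M)

/-- The `(M + j + 1)`-st largest eigenvalue of `A A† + B B†`, for `j < M`. -/
noncomputable def lowerEigenvalue (j : Fin M) : ℝ :=
  (isHermitian_interference A B).eigenvalues₀
    (finCongr (by rw [Fintype.card_fin, two_mul]) (Fin.natAdd M j))

theorem feedback1_eq_prod_lowerEigenvalue :
    feedback1 P A B = ∏ j, (1 + P / M * lowerEigenvalue A B j) := by
  have hcard : M + M = Fintype.card (Fin (2 * M)) := by rw [Fintype.card_fin, two_mul]
  have hupper (i : Fin M) : ¬ M ≤ (finCongr hcard (Fin.castAdd M i) : ℕ) := by simp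
  have hlower (i : Fin M) : M ≤ (finCongr hcard (Fin.natAdd M i) : ℕ) := by simp
  rw [feedback1, ← (finCongr hcard).prod_comp, Fin.prod_univ_add]
  simp only [if_neg (hupper _), if_pos (hlower _), Finset.prod_const_one, one_mul, lowerEigenvalue]

theorem posSemidef_mul_conjTranspose_add : (A * Aᴴ + B * Bᴴ).PosSemidef :=
  (Matrix.posSemidef_self_mul_conjTranspose A).add (Matrix.posSemidef_self_mul_conjTranspose B)

theorem lowerEigenvalue_nonneg (j : Fin M) : 0 ≤ lowerEigenvalue A B j := by
  have h := (posSemidef_mul_conjTranspose_add A B).eigenvalues_nonneg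
    (Fintype.equivOfCardEq (Fintype.card_fin _)
      (finCongr (by rw [Fintype.card_fin, two_mul]) (Fin.natAdd M j)))
  rwa [Matrix.IsHermitian.eigenvalues, Equiv.symm_apply_apply] at h

theorem one_le_feedback1 (hP : 0 ≤ P) : 1 ≤ feedback1 P A B := by
  rw [feedback1_eq_prod_lowerEigenvalue]
  refine Finset.one_le_prod fun j _ => le_add_of_nonneg_right ?_
  exact mul_nonneg (div_nonneg hP (Nat.cast_nonneg M)) (lowerEigenvalue_nonneg A B j)

/- The rows of `F` are eigenvectors of the `M` smallest eigenvalues. -/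
theorem exists_post_rateLoss_eq :
    ∃ F : Post M, F * Fᴴ = 1 ∧ rateLoss P F A B = Real.logb 2 (feedback1 P A B) := by
  obtain ⟨V, hV, hdiag⟩ := exists_frame_diagonal_eigenvalues₀ (isHermitian_interference A B)
    ((finCongr (by rw [Fintype.card_fin, two_mul])).injective.comp (Fin.natAdd_injective M M))
  refine ⟨Vᴴ, by rwa [Matrix.conjTranspose_conjTranspose], ?_⟩
  have hgram : Vᴴ * A * Aᴴ * V + Vᴴ * B * Bᴴ * V = Vᴴ * (A * Aᴴ + B * Bᴴ) * V := by
    simp only [Matrix.mul_add, Matrix.add_mul, Matrix.mul_assoc]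
  have hcov : interferenceCov P Vᴴ A B =
      Matrix.diagonal (fun j => ((1 + P / M * lowerEigenvalue A B j : ℝ) : ℂ)) := by
    rw [interferenceCov, Matrix.conjTranspose_conjTranspose, hgram, hdiag, ← Matrix.diagonal_one,
      ← Matrix.diagonal_smul, Matrix.diagonal_add]
    congr 1
    funext j
    simp [lowerEigenvalue]
  rw [rateLoss, hcov, Matrix.det_diagonal, ← Complex.ofReal_prod, Complex.ofReal_re,
    feedback1_eq_prod_lowerEigenvalue]

theorem IsOIAPostprocessing.rateLoss_le {F : ℕ → Channel M → Channel M → Post M}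
    (hF : IsOIAPostprocessing P F) (k : ℕ) :
    rateLoss P (F k A B) A B ≤ Real.logb 2 (feedback1 P A B) := by
  obtain ⟨F', hF', hloss⟩ := exists_post_rateLoss_eq (P := P) A B
  exact hloss ▸ hF.minimal k A B F' hF'

variable {A B}

/- `B x` only sees `R` on the kernel of `A†`, which has dimension at least `M`. -/
theorem lowerEigenvalue_le_of_eq_mul_add {R : Channel M} {C : Matrix (Fin M) (Fin M) ℂ}
    (hB : B = A * C + R) (j : Fin M) : lowerEigenvalue A B j ≤ ‖R‖ ^ 2 := by
  refine eigenvalues₀_le_of_forall_mulVec_eq_zero _ Aᴴ _ (by simp) fun x hx => ?_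
  have hBx : Bᴴ *ᵥ x = Rᴴ *ᵥ x := by
    rw [hB, Matrix.conjTranspose_add, Matrix.conjTranspose_mul, Matrix.add_mulVec,
      ← Matrix.mulVec_mulVec, hx, Matrix.mulVec_zero, zero_add]
  have hform : star x ⬝ᵥ ((A * Aᴴ + B * Bᴴ) *ᵥ x) = star (Rᴴ *ᵥ x) ⬝ᵥ (Rᴴ *ᵥ x) := by
    rw [Matrix.add_mulVec, ← Matrix.mulVec_mulVec, hx, Matrix.mulVec_zero, zero_add,
      ← Matrix.mulVec_mulVec, Matrix.dotProduct_mulVec, ← hBx, Matrix.star_mulVec,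
      Matrix.conjTranspose_conjTranspose]
  rw [hform, star_dotProduct_self_re, ← mul_pow, ← Matrix.frobenius_norm_conjTranspose R]
  gcongr
  exact norm_toLp_mulVec_le Rᴴ x

theorem feedback1_le_of_eq_mul_add (hP : 0 ≤ P) {R : Channel M} {C : Matrix (Fin M) (Fin M) ℂ}
    (hB : B = A * C + R) : feedback1 P A B ≤ (1 + P / M * ‖R‖ ^ 2) ^ M := by
  have hc : 0 ≤ P / M := div_nonneg hP (Nat.cast_nonneg M)
  rw [feedback1_eq_prod_lowerEigenvalue, ← Fin.prod_const]
  refine Finset.prod_le_prod (fun j _ => ?_) fun j _ => ?_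
  · exact add_nonneg zero_le_one (mul_nonneg hc (lowerEigenvalue_nonneg A B j))
  · gcongr
    exact lowerEigenvalue_le_of_eq_mul_add hB j

end Feedback

section Isometry

variable {l m n : Type*} [Fintype l] [Fintype m] [Fintype n] [DecidableEq n]

theorem norm_isometry_mul {E : Matrix m n ℂ} (hE : Eᴴ * E = 1) (X : Matrix n l ℂ) :
    ‖E * X‖ = ‖X‖ := by
  refine (sq_eq_sq₀ (norm_nonneg _) (norm_nonneg _)).1 ?_
  rw [frobenius_norm_sq_eq_trace, frobenius_norm_sq_eq_trace, Matrix.conjTranspose_mul,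
    Matrix.mul_assoc, ← Matrix.mul_assoc Eᴴ, hE, Matrix.one_mul]

theorem norm_sq_isometry {E : Matrix m n ℂ} (hE : Eᴴ * E = 1) :
    ‖E‖ ^ 2 = Fintype.card n := by
  rw [frobenius_norm_sq_eq_trace, hE, Matrix.trace_one, Complex.natCast_re]

theorem norm_sq_sub_proj {E : Matrix m n ℂ} (hE : Eᴴ * E = 1) (X : Matrix m l ℂ) :
    ‖X - E * (Eᴴ * X)‖ ^ 2 = ‖X‖ ^ 2 - ‖Eᴴ * X‖ ^ 2 := by
  have hgram : (X - E * (Eᴴ * X))ᴴ * (X - E * (Eᴴ * X)) = Xᴴ * X - (Eᴴ * X)ᴴ * (Eᴴ * X) := by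
    have hcancel : (E * (Eᴴ * X))ᴴ * (E * (Eᴴ * X)) = (Eᴴ * X)ᴴ * (Eᴴ * X) := by
      rw [Matrix.conjTranspose_mul, Matrix.mul_assoc, ← Matrix.mul_assoc Eᴴ, hE, Matrix.one_mul]
    rw [Matrix.conjTranspose_sub, Matrix.sub_mul, Matrix.mul_sub, Matrix.mul_sub, hcancel]
    simp only [Matrix.conjTranspose_mul, Matrix.conjTranspose_conjTranspose, Matrix.mul_assoc]
    abel
  simp only [frobenius_norm_sq_eq_trace, hgram, Matrix.trace_sub, Complex.sub_re]

theorem norm_sub_proj_le {E : Matrix m n ℂ} (hE : Eᴴ * E = 1) (X : Matrix m l ℂ) :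
    ‖X - E * (Eᴴ * X)‖ ≤ ‖X‖ := by
  refine le_of_sq_le_sq ?_ (norm_nonneg X)
  rw [norm_sq_sub_proj hE]
  exact sub_le_self _ (sq_nonneg _)

end Isometry

section Range

variable {l m n : Type*} [Fintype l] [Fintype n]

theorem exists_eq_mul_of_range_le {X : Matrix m n ℂ} {Y : Matrix m l ℂ}
    (h : LinearMap.range X.mulVecLin ≤ LinearMap.range Y.mulVecLin) :
    ∃ S : Matrix l n ℂ, X = Y * S := by
  classical
  have hcol (j : n) : ∃ v, Y *ᵥ v = X *ᵥ Pi.single j 1 := h ⟨_, rfl⟩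
  choose v hv using hcol
  refine ⟨(Matrix.of v)ᵀ, ?_⟩
  ext i j
  have h := congrFun (hv j) i
  rw [Matrix.mulVec_single_one] at h
  exact h.symm

theorem range_mul_le (X : Matrix m l ℂ) (S : Matrix l n ℂ) :
    LinearMap.range (X * S).mulVecLin ≤ LinearMap.range X.mulVecLin := by
  rw [Matrix.mulVecLin_mul]
  exact LinearMap.range_comp_le_range _ _

end Range

variable {M : ℕ} {P : ℝ} {A B A' B' : Channel M}

open scoped MatrixOrder Matrix.Norms.L2Operator in
theorem exists_isGenerator {H : Channel M} (hH : Function.Injective H.mulVec) :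
    ∃ A, IsGenerator A H := by
  have hpos := (Matrix.PosDef.conjTranspose_mul_self H hH).isStrictlyPositive
  obtain ⟨Y, hY, hgram⟩ := CStarAlgebra.isStrictlyPositive_iff_eq_star_mul_self.1 hpos
  have hdet : IsUnit Y.det := (Matrix.isUnit_iff_isUnit_det Y).1 hY
  refine ⟨H * Y⁻¹, ?_, le_antisymm (range_mul_le H Y⁻¹) ?_⟩
  · calc (H * Y⁻¹)ᴴ * (H * Y⁻¹) = (Y⁻¹)ᴴ * (Hᴴ * H) * Y⁻¹ := by
          rw [Matrix.conjTranspose_mul]; simp only [Matrix.mul_assoc]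
      _ = (Y * Y⁻¹)ᴴ * (Y * Y⁻¹) := by
          rw [hgram, Matrix.conjTranspose_mul, Matrix.star_eq_conjTranspose]
          simp only [Matrix.mul_assoc]
      _ = 1 := by rw [Matrix.mul_nonsing_inv Y hdet, Matrix.conjTranspose_one, Matrix.one_mul]
  · simpa only [Matrix.nonsing_inv_mul_cancel_right _ H hdet] using range_mul_le (H * Y⁻¹) Y

theorem chordalDistSq_comm (A B : Channel M) : chordalDistSq A B = chordalDistSq B A := by
  rw [chordalDistSq, chordalDistSq, Matrix.mul_assoc, Matrix.trace_mul_comm, Matrix.mul_assoc,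
    Matrix.mul_assoc, ← Matrix.mul_assoc Bᴴ, Matrix.trace_mul_comm, ← Matrix.mul_assoc]

theorem chordalDistSq_eq_norm_sq (hA : Aᴴ * A = 1) (hB : Bᴴ * B = 1) :
    chordalDistSq A B = ‖A - B * (Bᴴ * A)‖ ^ 2 := by
  rw [norm_sq_sub_proj hB, norm_sq_isometry hA, Fintype.card_fin, frobenius_norm_sq_eq_trace,
    chordalDistSq, Matrix.conjTranspose_mul, Matrix.conjTranspose_conjTranspose]
  simp only [Matrix.mul_assoc]

theorem feedback1_le_norm_sub (hP : 0 ≤ P) (A B : Channel M) :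
    feedback1 P A B ≤ (1 + P / M * ‖B - A‖ ^ 2) ^ M :=
  feedback1_le_of_eq_mul_add hP (C := 1) (by rw [Matrix.mul_one, add_sub_cancel])

theorem feedback1_le_chordalDistSq (hP : 0 ≤ P) (hA : IsGenerator A' A) (hB : IsGenerator B' B) :
    feedback1 P A B ≤ (1 + P / M * (‖B‖ ^ 2 * chordalDistSq A' B')) ^ M := by
  obtain ⟨C, hC⟩ := exists_eq_mul_of_range_le hA.2.le
  obtain ⟨R, hR⟩ := exists_eq_mul_of_range_le hB.2.ge
  have hsplit : B = A * (C * (A'ᴴ * B' * R)) + (B' - A' * (A'ᴴ * B')) * R := by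
    rw [← Matrix.mul_assoc, ← hC, Matrix.sub_mul, ← hR]
    simp only [Matrix.mul_assoc, add_sub_cancel]
  have hnormR : ‖R‖ = ‖B‖ := by rw [hR, norm_isometry_mul hB.1]
  have : 0 ≤ P / M := div_nonneg hP (Nat.cast_nonneg M)
  refine (feedback1_le_of_eq_mul_add hP hsplit).trans ?_
  rw [chordalDistSq_comm, chordalDistSq_eq_norm_sq hB.1 hA.1, ← hnormR, ← mul_pow, mul_comm ‖R‖]
  gcongr
  exact Matrix.frobenius_norm_mul _ _

theorem norm_le_of_isometry_mul {E : Channel M} {S : Matrix (Fin M) (Fin M) ℂ} (hE : Eᴴ * E = 1)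
    (hAE : ‖A - E‖ ≤ 1 / 2) (hS : (A * S)ᴴ * (A * S) = 1) : ‖S‖ ≤ 2 * √M := by
  have hAS : ‖A * S‖ = √M := by
    rw [← Real.sqrt_sq (norm_nonneg (A * S)), norm_sq_isometry hS, Fintype.card_fin]
  have hES : E * S = A * S - (A - E) * S := by rw [Matrix.sub_mul, sub_sub_cancel]
  have hbound : ‖S‖ ≤ √M + 1 / 2 * ‖S‖ := calc
    ‖S‖ = ‖A * S - (A - E) * S‖ := by rw [← hES, norm_isometry_mul hE]
    _ ≤ ‖A * S‖ + ‖(A - E) * S‖ := norm_sub_le _ _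
    _ ≤ √M + 1 / 2 * ‖S‖ := by
        rw [hAS]
        gcongr
        refine (Matrix.frobenius_norm_mul _ _).trans ?_
        gcongr
  linarith

theorem chordalDistSq_le_norm_sub {E : Channel M} (hE : Eᴴ * E = 1) (hAE : ‖A - E‖ ≤ 1 / 2)
    (hA : IsGenerator A' A) (hB : IsGenerator B' B) :
    chordalDistSq A' B' ≤ 4 * M * ‖A - B‖ ^ 2 := by
  obtain ⟨S, rfl⟩ := exists_eq_mul_of_range_le hA.2.le
  obtain ⟨R, rfl⟩ := exists_eq_mul_of_range_le hB.2.ge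
  have hproj : A * S - B' * (B'ᴴ * (A * S)) =
      (A - B' * R) * S - B' * (B'ᴴ * ((A - B' * R) * S)) := by
    have hcancel : B' * (B'ᴴ * (B' * R * S)) = B' * R * S := by
      rw [Matrix.mul_assoc B' R, ← Matrix.mul_assoc B'ᴴ, hB.1, Matrix.one_mul]
    rw [Matrix.sub_mul, Matrix.mul_sub, Matrix.mul_sub, hcancel]
    abel
  calc chordalDistSq (A * S) B' = ‖A * S - B' * (B'ᴴ * (A * S))‖ ^ 2 :=
        chordalDistSq_eq_norm_sq hA.1 hB.1
    _ ≤ (‖A - B' * R‖ * (2 * √M)) ^ 2 := by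
        rw [hproj]
        gcongr
        refine (norm_sub_proj_le hB.1 _).trans ((Matrix.frobenius_norm_mul _ _).trans ?_)
        gcongr
        exact norm_le_of_isometry_mul hE hAE hA.1
    _ = 4 * M * ‖A - B' * R‖ ^ 2 := by
        rw [mul_pow, mul_pow, Real.sq_sqrt (Nat.cast_nonneg M)]
        ring

instance : IsGaussian complexGaussian :=
  isGaussian_map_equiv (μ := (gaussianReal 0 (1 / 2)).prod (gaussianReal 0 (1 / 2)))
    Complex.equivRealProdCLM.symm

theorem measurable_complex_mk : Measurable (fun p : ℝ × ℝ => (⟨p.1, p.2⟩ : ℂ)) :=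
  Complex.equivRealProdCLM.symm.continuous.measurable

theorem complexGaussian_absolutelyContinuous : complexGaussian ≪ volume := by
  have hreal : gaussianReal 0 (1 / 2) ≪ volume :=
    gaussianReal_absolutelyContinuous 0 (by norm_num)
  have hmap := (hreal.prod hreal).map Complex.measurableEquivRealProd.symm.measurable
  rwa [← Measure.volume_eq_prod, Complex.volume_preserving_equiv_real_prod.symm.map_eq] at hmap

theorem integral_cexp_gaussianReal (a : ℝ) :
    ∫ x : ℝ, Complex.exp (a * x * Complex.I) ∂(gaussianReal 0 (1 / 2)) =
      Complex.exp ((-(a ^ 2 / 4) : ℝ) : ℂ) := by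
  rw [← charFun_apply_real, charFun_gaussianReal]
  congr 1
  push_cast
  ring

theorem integral_cexp_complexGaussian (t : ℂ) :
    ∫ z, Complex.exp (((star t * z).re : ℂ) * Complex.I) ∂complexGaussian =
      Complex.exp ((-(‖t‖ ^ 2 / 4) : ℝ) : ℂ) := by
  have hsplit (p : ℝ × ℝ) : Complex.exp (((star t * (⟨p.1, p.2⟩ : ℂ)).re : ℂ) * Complex.I) =
      Complex.exp (t.re * p.1 * Complex.I) * Complex.exp (t.im * p.2 * Complex.I) := by
    rw [← Complex.exp_add]
    congr 1
    simp
    ring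
  rw [complexGaussian, integral_map measurable_complex_mk.aemeasurable
    (Continuous.aestronglyMeasurable (by fun_prop))]
  simp_rw [hsplit]
  rw [integral_prod_mul (fun x : ℝ => Complex.exp (t.re * x * Complex.I))
    (fun y : ℝ => Complex.exp (t.im * y * Complex.I)), integral_cexp_gaussianReal,
    integral_cexp_gaussianReal, ← Complex.exp_add, ← Complex.normSq_eq_norm_sq,
    Complex.normSq_apply]
  congr 1
  push_cast
  ring

/-- The law of an `m × n` matrix with i.i.d. `CN(0, 1)` entries; this is the rectangular analogue
of `gaussianMatrix`, as a measure on matrices rather than on functions of two indices. -/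
noncomputable def matrixGaussian (m n : ℕ) : Measure (Matrix (Fin m) (Fin n) ℂ) :=
  (Measure.pi fun _ => Measure.pi fun _ => complexGaussian : Measure (Fin m → Fin n → ℂ))

section MatrixGaussian

variable {m n p : ℕ}

instance : IsProbabilityMeasure (matrixGaussian m n) :=
  inferInstanceAs (IsProbabilityMeasure
    (Measure.pi fun _ => Measure.pi fun _ => complexGaussian : Measure (Fin m → Fin n → ℂ)))

instance : BorelSpace (Matrix (Fin m) (Fin n) ℂ) :=
  inferInstanceAs (BorelSpace (Fin m → Fin n → ℂ))

instance : SecondCountableTopology (Matrix (Fin m) (Fin n) ℂ) :=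
  inferInstanceAs (SecondCountableTopology (Fin m → Fin n → ℂ))

theorem measurePreserving_entry (i : Fin m) (j : Fin n) :
    MeasurePreserving (fun X : Matrix (Fin m) (Fin n) ℂ => X i j)
      (matrixGaussian m n) complexGaussian :=
  (measurePreserving_eval (fun _ : Fin n => complexGaussian) j).comp
    (measurePreserving_eval (fun _ : Fin m => Measure.pi fun _ : Fin n => complexGaussian) i)

theorem re_trace_conjTranspose_mul (T X : Matrix (Fin m) (Fin n) ℂ) :
    (Tᴴ * X).trace.re = ∑ i, ∑ j, (star (T i j) * X i j).re := by
  rw [Finset.sum_comm]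
  simp only [Matrix.trace, Matrix.diag_apply, Matrix.mul_apply, Matrix.conjTranspose_apply,
    Complex.re_sum]

theorem integral_cexp_matrixGaussian (T : Matrix (Fin m) (Fin n) ℂ) :
    ∫ X, Complex.exp (((Tᴴ * X).trace.re : ℂ) * Complex.I) ∂matrixGaussian m n =
      Complex.exp ((-(‖T‖ ^ 2 / 4) : ℝ) : ℂ) := by
  have hprod (X : Fin m → Fin n → ℂ) :
      Complex.exp (((Tᴴ * Matrix.of X).trace.re : ℂ) * Complex.I) =
        ∏ i, ∏ j, Complex.exp (((star (T i j) * X i j).re : ℂ) * Complex.I) := by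
    simp_rw [← Complex.exp_sum, re_trace_conjTranspose_mul, Matrix.of_apply, Complex.ofReal_sum,
      Finset.sum_mul]
  have hrow (i : Fin m) : ∫ x : Fin n → ℂ,
      ∏ j, Complex.exp (((star (T i j) * x j).re : ℂ) * Complex.I)
        ∂(Measure.pi fun _ => complexGaussian) =
      ∏ j, Complex.exp ((-(‖T i j‖ ^ 2 / 4) : ℝ) : ℂ) := by
    rw [integral_fintype_prod_eq_prod (fun j (z : ℂ) =>
      Complex.exp (((star (T i j) * z).re : ℂ) * Complex.I))]
    exact Finset.prod_congr rfl fun j _ => integral_cexp_complexGaussian _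
  calc ∫ X, Complex.exp (((Tᴴ * X).trace.re : ℂ) * Complex.I) ∂matrixGaussian m n
      = ∫ X : Fin m → Fin n → ℂ,
          ∏ i, ∏ j, Complex.exp (((star (T i j) * X i j).re : ℂ) * Complex.I)
            ∂(Measure.pi fun _ => Measure.pi fun _ => complexGaussian) :=
        integral_congr_ae (.of_forall hprod)
    _ = ∏ i, ∏ j, Complex.exp ((-(‖T i j‖ ^ 2 / 4) : ℝ) : ℂ) := by
        rw [integral_fintype_prod_eq_prod (fun i (x : Fin n → ℂ) =>
          ∏ j, Complex.exp (((star (T i j) * x j).re : ℂ) * Complex.I))]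
        exact Finset.prod_congr rfl fun i _ => hrow i
    _ = Complex.exp ((-(‖T‖ ^ 2 / 4) : ℝ) : ℂ) := by
        simp_rw [← Complex.exp_sum, ← Complex.ofReal_sum, frobenius_norm_sq,
          Finset.sum_neg_distrib, Finset.sum_div]

/-- The real inner product `(X, T) ↦ Re tr (Tᴴ X)` on complex matrices, against which the
characteristic functions of random matrices are taken. -/
noncomputable def tracePairing (m n : ℕ) :
    Matrix (Fin m) (Fin n) ℂ →ₗ[ℝ] Matrix (Fin m) (Fin n) ℂ →ₗ[ℝ] ℝ :=
  LinearMap.mk₂ ℝ (fun X T => (Tᴴ * X).trace.re)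
    (fun X Y T => by rw [Matrix.mul_add, Matrix.trace_add, Complex.add_re])
    (fun c X T => by rw [Matrix.mul_smul, Matrix.trace_smul, Complex.smul_re])
    (fun X S T => by
      rw [Matrix.conjTranspose_add, Matrix.add_mul, Matrix.trace_add, Complex.add_re])
    (fun c X T => by
      rw [Matrix.conjTranspose_smul, star_trivial, Matrix.smul_mul, Matrix.trace_smul,
        Complex.smul_re])

theorem ext_of_integral_cexp_trace_eq {μ ν : Measure (Matrix (Fin m) (Fin n) ℂ)}
    [IsFiniteMeasure μ] [IsFiniteMeasure ν]
    (h : ∀ T : Matrix (Fin m) (Fin n) ℂ,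
      ∫ X, Complex.exp (((Tᴴ * X).trace.re : ℂ) * Complex.I) ∂μ =
      ∫ X, Complex.exp (((Tᴴ * X).trace.re : ℂ) * Complex.I) ∂ν) :
    μ = ν := by
  have hcont : Continuous fun q : Matrix (Fin m) (Fin n) ℂ × Matrix (Fin m) (Fin n) ℂ =>
      (q.2ᴴ * q.1).trace.re := by fun_prop
  have hsep (X : Matrix (Fin m) (Fin n) ℂ) (hX : X ≠ 0) : tracePairing m n X ≠ 0 := fun h0 => by
    have hXX : (Xᴴ * X).trace.re = 0 := LinearMap.congr_fun h0 X
    rw [← frobenius_norm_sq_eq_trace, sq_eq_zero_iff, norm_eq_zero] at hXX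
    exact hX hXX
  have hμ : @IsFiniteMeasure (Fin m → Fin n → ℂ) MeasurableSpace.pi μ := ‹_›
  have hν : @IsFiniteMeasure (Fin m → Fin n → ℂ) MeasurableSpace.pi ν := ‹_›
  exact ext_of_integral_char_eq (V := Fin m → Fin n → ℂ) (L := tracePairing m n)
    (P := μ) (P' := ν) Real.continuous_probChar Real.probChar_ne_one hsep hcont h

theorem map_mul_matrixGaussian {F : Matrix (Fin p) (Fin m) ℂ} (hF : F * Fᴴ = 1) :
    (matrixGaussian m n).map (fun X => F * X) = matrixGaussian p n := by
  have hmeas : Measurable (fun X : Matrix (Fin m) (Fin n) ℂ => F * X) :=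
    Continuous.measurable (by fun_prop)
  have := Measure.isProbabilityMeasure_map (μ := matrixGaussian m n) hmeas.aemeasurable
  refine ext_of_integral_cexp_trace_eq fun T => ?_
  have hadj (X : Matrix (Fin m) (Fin n) ℂ) : Tᴴ * (F * X) = (Fᴴ * T)ᴴ * X := by
    rw [Matrix.conjTranspose_mul, Matrix.conjTranspose_conjTranspose, Matrix.mul_assoc]
  have hnorm : ‖Fᴴ * T‖ = ‖T‖ := norm_isometry_mul (by rwa [Matrix.conjTranspose_conjTranspose]) T
  rw [integral_map hmeas.aemeasurable (Continuous.aestronglyMeasurable (by fun_prop))]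
  simp_rw [hadj, integral_cexp_matrixGaussian, hnorm]

theorem absolutelyContinuous_pi {α : Type*} [MeasurableSpace α] {μ ν : Measure α} [SigmaFinite μ]
    [SigmaFinite ν] (h : μ ≪ ν) (n : ℕ) :
    (Measure.pi fun _ : Fin n => μ) ≪ Measure.pi fun _ : Fin n => ν := by
  induction n with
  | zero => rw [Measure.pi_of_empty, Measure.pi_of_empty]
  | succ n ih =>
    have hmap := (h.prod ih).map (MeasurableEquiv.piFinSuccAbove (fun _ => α) 0).symm.measurable
    rwa [(measurePreserving_piFinSuccAbove (fun _ : Fin (n + 1) => μ) 0).symm.map_eq,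
      (measurePreserving_piFinSuccAbove (fun _ : Fin (n + 1) => ν) 0).symm.map_eq] at hmap

theorem matrixGaussian_absolutelyContinuous :
    matrixGaussian m n ≪ (volume : Measure (Fin m → Fin n → ℂ)) :=
  absolutelyContinuous_pi (absolutelyContinuous_pi complexGaussian_absolutelyContinuous n) m

/- On every line `t ↦ X + t I`, the determinant is a nonzero polynomial in `t`, up to sign the
characteristic polynomial of `-X`. -/
theorem ae_volume_det_ne_zero (n : ℕ) :
    ∀ᵐ X : Fin n → Fin n → ℂ, (Matrix.of X).det ≠ 0 := by
  have : (volume : Measure (Fin n → Fin n → ℂ)).IsAddHaarMeasure :=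
    Measure.pi.isAddHaarMeasure _
  have hcont : Continuous fun X : Fin n → Fin n → ℂ => (Matrix.of X).det :=
    Continuous.matrix_det continuous_id
  refine ae_mem_of_ae_add_linearMap_mem
    (LinearMap.toSpanSingleton ℝ (Fin n → Fin n → ℂ) (1 : Matrix (Fin n) (Fin n) ℂ))
    volume volume (isOpen_ne_fun hcont continuous_const).measurableSet fun X => ?_
  have hfin : {t : ℝ | (-Matrix.of X).charpoly.IsRoot (t : ℂ)}.Finite :=
    (Polynomial.finite_setOfPred_isRoot (Matrix.charpoly_monic _).ne_zero).preimage
      Complex.ofReal_injective.injOn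
  filter_upwards [hfin.countable.ae_notMem volume] with t ht
  have hline : Matrix.of X + t • (1 : Matrix (Fin n) (Fin n) ℂ) =
      Matrix.scalar _ (t : ℂ) - -Matrix.of X := by
    rw [sub_neg_eq_add, add_comm (Matrix.scalar _ _), Matrix.scalar_apply,
      ← Matrix.smul_one_eq_diagonal, Complex.coe_smul]
  change (Matrix.of X + t • (1 : Matrix (Fin n) (Fin n) ℂ)).det ≠ 0
  rw [hline, ← Matrix.eval_charpoly]
  exact ht

theorem ae_matrixGaussian_det_ne_zero (n : ℕ) : ∀ᵐ X ∂matrixGaussian n n, X.det ≠ 0 :=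
  matrixGaussian_absolutelyContinuous (ae_volume_det_ne_zero n)

theorem exists_conjTranspose_mul_self_eq_one (h : n ≤ m) :
    ∃ E : Matrix (Fin m) (Fin n) ℂ, Eᴴ * E = 1 := by
  refine ⟨(1 : Matrix (Fin m) (Fin m) ℂ).submatrix id (Fin.castLE h), ?_⟩
  rw [Matrix.conjTranspose_submatrix, Matrix.conjTranspose_one,
    Matrix.submatrix_mul _ _ _ _ _ Function.bijective_id |>.symm, Matrix.one_mul,
    Matrix.submatrix_one _ (Fin.castLE_injective h)]

/- If `E` has orthonormal columns, then `Eᴴ X` is a square Gaussian matrix. -/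
theorem ae_matrixGaussian_injective_mulVec (h : n ≤ m) :
    ∀ᵐ X ∂matrixGaussian m n, Function.Injective X.mulVec := by
  obtain ⟨E, hE⟩ := exists_conjTranspose_mul_self_eq_one h
  have hmeas : Measurable (fun X : Matrix (Fin m) (Fin n) ℂ => Eᴴ * X) :=
    Continuous.measurable (by fun_prop)
  have hae : ∀ᵐ Y ∂(matrixGaussian m n).map (fun X => Eᴴ * X), Y.det ≠ 0 := by
    rw [map_mul_matrixGaussian (by rwa [Matrix.conjTranspose_conjTranspose])]
    exact ae_matrixGaussian_det_ne_zero n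
  filter_upwards [ae_of_ae_map hmeas.aemeasurable hae] with X hX
  have hinj : Function.Injective (Eᴴ * X).mulVec :=
    Matrix.mulVec_injective_of_isUnit
      ((Matrix.isUnit_iff_isUnit_det _).2 (isUnit_iff_ne_zero.2 hX))
  refine Function.Injective.of_comp (f := Eᴴ.mulVec) ?_
  convert! hinj using 1
  funext v
  exact Matrix.mulVec_mulVec v Eᴴ X

end MatrixGaussian

theorem exists_mul_le_gaussianReal_Icc (m : ℝ) {v : NNReal} (hv : v ≠ 0) (a : ℝ) :
    ∃ κ : ℝ, 0 < κ ∧ ∀ δ, 0 ≤ δ → δ ≤ 1 →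
      κ * δ ≤ (gaussianReal m v).real (Set.Icc (a - δ) (a + δ)) := by
  have hpos : 0 < gaussianPDFReal m v (m + (|a - m| + 1)) := gaussianPDFReal_pos _ _ _ hv
  refine ⟨gaussianPDFReal m v (m + (|a - m| + 1)) * 2, by positivity, fun δ hδ0 hδ1 => ?_⟩
  have hpdf (x : ℝ) (hx : x ∈ Set.Icc (a - δ) (a + δ)) :
      gaussianPDFReal m v (m + (|a - m| + 1)) ≤ gaussianPDFReal m v x := by
    have hdist : |x - m| ≤ |a - m| + 1 := by
      rw [abs_le]
      constructor <;> linarith [hx.1, hx.2, neg_abs_le (a - m), le_abs_self (a - m)]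
    have hsq : (x - m) ^ 2 ≤ (|a - m| + 1) ^ 2 :=
      sq_le_sq.2 (hdist.trans (le_abs_self _))
    simp only [gaussianPDFReal_def, add_sub_cancel_left]
    gcongr
  have hvol : volume.real (Set.Icc (a - δ) (a + δ)) = 2 * δ := by
    rw [Real.volume_real_Icc_of_le (by linarith)]
    ring
  rw [measureReal_def, gaussianReal_apply_eq_integral m hv, ENNReal.toReal_ofReal
    (integral_nonneg fun _ => gaussianPDFReal_nonneg _ _ _), mul_assoc, ← hvol]
  exact setIntegral_ge_of_const_le_real measurableSet_Icc measure_Icc_lt_top.ne hpdf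
    (integrable_gaussianPDFReal m v).integrableOn

theorem exists_mul_sq_le_complexGaussian_closedBall (a : ℂ) :
    ∃ κ : ℝ, 0 < κ ∧ ∀ δ, 0 ≤ δ → δ ≤ 1 →
      κ * δ ^ 2 ≤ complexGaussian.real (Metric.closedBall a δ) := by
  obtain ⟨κ₁, hκ₁, hre⟩ := exists_mul_le_gaussianReal_Icc 0 (v := 1 / 2) (by norm_num) a.re
  obtain ⟨κ₂, hκ₂, him⟩ := exists_mul_le_gaussianReal_Icc 0 (v := 1 / 2) (by norm_num) a.im
  refine ⟨κ₁ * κ₂ / 4, by positivity, fun δ hδ0 hδ1 => ?_⟩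
  have hbox : Set.Icc (a.re - δ / 2) (a.re + δ / 2) ×ˢ Set.Icc (a.im - δ / 2) (a.im + δ / 2) ⊆
      (fun p : ℝ × ℝ => (⟨p.1, p.2⟩ : ℂ)) ⁻¹' Metric.closedBall a δ := by
    rintro ⟨x, y⟩ ⟨hx, hy⟩
    rw [Set.mem_preimage, mem_closedBall_iff_norm]
    refine (Complex.norm_le_abs_re_add_abs_im _).trans ?_
    have hx' : |x - a.re| ≤ δ / 2 := abs_sub_le_iff.2 ⟨by linarith [hx.2], by linarith [hx.1]⟩
    have hy' : |y - a.im| ≤ δ / 2 := abs_sub_le_iff.2 ⟨by linarith [hy.2], by linarith [hy.1]⟩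
    simp only [Complex.sub_re, Complex.sub_im]
    linarith
  rw [complexGaussian, map_measureReal_apply measurable_complex_mk
    Metric.isClosed_closedBall.measurableSet]
  refine le_trans ?_ (measureReal_mono hbox)
  rw [measureReal_prod_prod]
  calc κ₁ * κ₂ / 4 * δ ^ 2 = (κ₁ * (δ / 2)) * (κ₂ * (δ / 2)) := by ring
    _ ≤ _ := mul_le_mul (hre _ (by linarith) (by linarith)) (him _ (by linarith) (by linarith))
      (by positivity) measureReal_nonneg

section GaussianBounds

variable {m n : ℕ}

theorem norm_le_sum_norm_entry (X : Matrix (Fin m) (Fin n) ℂ) : ‖X‖ ≤ ∑ i, ∑ j, ‖X i j‖ := by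
  refine le_of_sq_le_sq ?_ (by positivity)
  rw [frobenius_norm_sq, ← Finset.sum_product', ← Finset.sum_product']
  exact Finset.sum_sq_le_sq_sum_of_nonneg fun _ _ => norm_nonneg _

theorem measurable_norm_matrix : Measurable fun X : Matrix (Fin m) (Fin n) ℂ => ‖X‖ := by
  have hsqrt (X : Matrix (Fin m) (Fin n) ℂ) : ‖X‖ = √(∑ i, ∑ j, ‖X i j‖ ^ 2) := by
    rw [← frobenius_norm_sq, Real.sqrt_sq (norm_nonneg X)]
  simp_rw [hsqrt]
  exact Continuous.measurable (by fun_prop)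

theorem matrixGaussian_forall_entry_mem (s : Fin m → Fin n → Set ℂ) :
    matrixGaussian m n {X | ∀ i j, X i j ∈ s i j} = ∏ i, ∏ j, complexGaussian (s i j) := by
  have hpi : {X : Fin m → Fin n → ℂ | ∀ i j, X i j ∈ s i j} =
      Set.univ.pi fun i => Set.univ.pi fun j => s i j := by
    ext X
    simp only [Set.mem_ofPred_eq, Set.mem_univ_pi]
  change (Measure.pi fun _ => Measure.pi fun _ => complexGaussian :
    Measure (Fin m → Fin n → ℂ)) {X | ∀ i j, X i j ∈ s i j} = _
  simp_rw [hpi, Measure.pi_pi]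

theorem exists_mul_pow_le_matrixGaussian_closedBall (A : Matrix (Fin m) (Fin n) ℂ) :
    ∃ κ : ℝ, 0 < κ ∧ ∀ δ, 0 ≤ δ → δ ≤ 1 →
      κ * δ ^ (2 * (m * n)) ≤ (matrixGaussian m n).real (Metric.closedBall A δ) := by
  choose κ hκ hball using fun i j => exists_mul_sq_le_complexGaussian_closedBall (A i j)
  refine ⟨(∏ i, ∏ j, κ i j) / (m * n + 1) ^ (2 * (m * n)),
    div_pos (Finset.prod_pos fun i _ => Finset.prod_pos fun j _ => hκ i j) (by positivity),
    fun δ hδ0 hδ1 => ?_⟩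
  set ε : ℝ := δ / (m * n + 1) with hε
  have hε0 : 0 ≤ ε := by positivity
  have hεδ : m * n * ε ≤ δ := by
    rw [hε, mul_div_assoc', div_le_iff₀ (by positivity)]
    linarith
  have hε1 : ε ≤ 1 := div_le_one_of_le₀ (by nlinarith [Nat.cast_nonneg (α := ℝ) (m * n)])
    (by positivity)
  have hbox : {X : Matrix (Fin m) (Fin n) ℂ | ∀ i j, X i j ∈ Metric.closedBall (A i j) ε} ⊆
      Metric.closedBall A δ := by
    intro X hX
    refine mem_closedBall_iff_norm.2 ?_
    calc ‖X - A‖ ≤ ∑ i, ∑ j, ‖(X - A) i j‖ := norm_le_sum_norm_entry _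
      _ ≤ ∑ _i : Fin m, ∑ _j : Fin n, ε := by
        refine Finset.sum_le_sum fun i _ => Finset.sum_le_sum fun j _ => ?_
        rw [Matrix.sub_apply, ← mem_closedBall_iff_norm]
        exact hX i j
      _ = m * n * ε := by simp [mul_assoc]
      _ ≤ δ := hεδ
  refine le_trans ?_ (measureReal_mono hbox)
  simp_rw [measureReal_def, matrixGaussian_forall_entry_mem, ENNReal.toReal_prod,
    ← measureReal_def]
  calc (∏ i, ∏ j, κ i j) / (m * n + 1) ^ (2 * (m * n)) * δ ^ (2 * (m * n))
      = ∏ i, ∏ j, κ i j * ε ^ 2 := by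
        simp only [Finset.prod_mul_distrib, Finset.prod_const, Finset.card_univ, Fintype.card_fin,
          hε, div_pow, ← pow_mul]
        ring
    _ ≤ _ := Finset.prod_le_prod
      (fun i _ => Finset.prod_nonneg fun j _ => mul_nonneg (hκ i j).le (sq_nonneg ε)) fun i _ =>
        Finset.prod_le_prod (fun j _ => mul_nonneg (hκ i j).le (sq_nonneg ε))
          fun j _ => hball i j ε hε0 hε1

theorem memLp_norm_matrixGaussian (q : ℕ) :
    MemLp (fun X : Matrix (Fin m) (Fin n) ℂ => ‖X‖) q (matrixGaussian m n) := by
  have hentry (i : Fin m) (j : Fin n) :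
      MemLp (fun X : Matrix (Fin m) (Fin n) ℂ => ‖X i j‖) q (matrixGaussian m n) :=
    ((IsGaussian.memLp_id complexGaussian q (by simp)).norm).comp_measurePreserving
      (measurePreserving_entry i j)
  have hsum := memLp_finsetSum Finset.univ fun i _ => memLp_finsetSum Finset.univ fun j _ =>
    hentry i j
  refine hsum.mono measurable_norm_matrix.aestronglyMeasurable (.of_forall fun X => ?_)
  rw [norm_norm]
  exact (norm_le_sum_norm_entry X).trans (le_abs_self _)

theorem exists_matrixGaussian_norm_ge_le (m n q : ℕ) :
    ∃ C : ℝ, ∀ s, 0 < s → (matrixGaussian m n).real {X | s ≤ ‖X‖} ≤ C / s ^ q := by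
  refine ⟨∫ X, ‖X‖ ^ q ∂matrixGaussian m n, fun s hs => ?_⟩
  have hint : Integrable (fun X : Matrix (Fin m) (Fin n) ℂ => ‖X‖ ^ q) (matrixGaussian m n) := by
    simpa only [norm_norm] using (memLp_norm_matrixGaussian q).integrable_norm_pow'
  rw [le_div_iff₀ (pow_pos hs q), mul_comm]
  calc s ^ q * (matrixGaussian m n).real {X | s ≤ ‖X‖}
      ≤ s ^ q * (matrixGaussian m n).real {X | s ^ q ≤ ‖X‖ ^ q} := by
        refine mul_le_mul_of_nonneg_left (measureReal_mono fun X hX => ?_) (by positivity)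
        exact pow_le_pow_left₀ hs.le hX q
    _ ≤ _ := mul_meas_ge_le_integral_of_nonneg (.of_forall fun X => by positivity) hint _

theorem measurable_logDet {n : ℕ} :
    Measurable (logDet : Matrix (Fin n) (Fin n) ℂ → ℝ) := by
  have hdet : Continuous fun S : Matrix (Fin n) (Fin n) ℂ => (1 + S).det.re :=
    Complex.continuous_re.comp (Continuous.matrix_det (by fun_prop))
  exact (Real.measurable_log.comp hdet.measurable).div_const _

theorem measurable_signalCov {m : ℕ} (M : ℕ) (P : ℝ) :
    Measurable (signalCov M P : Matrix (Fin m) (Fin M) ℂ → Matrix (Fin m) (Fin m) ℂ) :=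
  Continuous.measurable (by unfold signalCov; fun_prop)

theorem measurable_pointToPointRate {M : ℕ} (P : ℝ) :
    Measurable (pointToPointRate (M := M) P) :=
  measurable_logDet.comp (measurable_signalCov M P)

theorem integrable_pointToPointRate {M : ℕ} {P : ℝ} (hP : 0 ≤ P) :
    Integrable (pointToPointRate P) (matrixGaussian M M) := by
  have hsq : Integrable (fun X : Matrix (Fin M) (Fin M) ℂ => P / M * ‖X‖ ^ 2 / Real.log 2)
      (matrixGaussian M M) :=
    (((memLp_norm_matrixGaussian 2).integrable_sq).const_mul _).div_const _
  refine hsq.mono' (measurable_pointToPointRate P).aestronglyMeasurable (.of_forall fun X => ?_)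
  rw [Real.norm_of_nonneg (pointToPointRate_nonneg hP X)]
  exact pointToPointRate_le hP X

end GaussianBounds

section Extremes

variable {X : Type*} [MeasurableSpace X] {ν : Measure X} [IsProbabilityMeasure ν]

theorem pi_real_forall_notMem_le {S : Set X} (hS : MeasurableSet S) (N : ℕ) :
    (Measure.pi fun _ : Fin N => ν).real {G | ∀ k, G k ∉ S} ≤ Real.exp (-(N * ν.real S)) := by
  have hpi : {G : Fin N → X | ∀ k, G k ∉ S} = Set.univ.pi fun _ => Sᶜ := by
    ext G
    simp only [Set.mem_ofPred_eq, Set.mem_univ_pi, Set.mem_compl_iff]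
  calc (Measure.pi fun _ : Fin N => ν).real {G | ∀ k, G k ∉ S} = (1 - ν.real S) ^ N := by
        rw [hpi, measureReal_def, Measure.pi_pi, ENNReal.toReal_prod, Finset.prod_const,
          Finset.card_univ, Fintype.card_fin, ← measureReal_def, probReal_compl_eq_one_sub hS]
    _ ≤ Real.exp (-ν.real S) ^ N :=
        pow_le_pow_left₀ (sub_nonneg.2 measureReal_le_one) (Real.one_sub_le_exp_neg _) N
    _ = Real.exp (-(N * ν.real S)) := by rw [← Real.exp_nat_mul, mul_neg]

theorem pi_real_exists_mem_le {T : Set X} (hT : MeasurableSet T) (N : ℕ) :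
    (Measure.pi fun _ : Fin N => ν).real {G | ∃ k, G k ∈ T} ≤ N * ν.real T := by
  have hUnion : {G : Fin N → X | ∃ k, G k ∈ T} = ⋃ k, Function.eval k ⁻¹' T := by
    ext G
    simp only [Set.mem_ofPred_eq, Set.mem_iUnion, Set.mem_preimage, Function.eval]
  calc (Measure.pi fun _ : Fin N => ν).real {G | ∃ k, G k ∈ T}
      ≤ ∑ k, (Measure.pi fun _ : Fin N => ν).real (Function.eval k ⁻¹' T) :=
        hUnion ▸ measureReal_iUnion_fintype_le _
    _ = N * ν.real T := by
        simp only [(measurePreserving_eval (fun _ : Fin N => ν) _).measureReal_preimage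
          hT.nullMeasurableSet, Finset.sum_const, Finset.card_univ, Fintype.card_fin,
          nsmul_eq_mul]

end Extremes

section Selection

variable {M K : ℕ} {P : ℝ} {sel : Selection M} {G : Fin (K + 1) → Channel M × Channel M}
  {E : Channel M} {δ R : ℝ} {k : Fin (K + 1)}

theorem norm_sub_le_of_mem_closedBall {A B : Channel M} (hA : A ∈ Metric.closedBall E δ)
    (hB : B ∈ Metric.closedBall E δ) : ‖A - B‖ ≤ 2 * δ := by
  linarith [norm_sub_le_norm_sub_add_norm_sub A E B, norm_sub_rev E B,
    mem_closedBall_iff_norm.1 hA, mem_closedBall_iff_norm.1 hB]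

theorem IsOIA1Selection.feedback1_le (hsel : IsOIA1Selection P sel) (hP : 0 ≤ P)
    (hk : G k ∈ Metric.closedBall E δ ×ˢ Metric.closedBall E δ) :
    feedback1 P (G (sel K G)).1 (G (sel K G)).2 ≤ (1 + P / M * (2 * δ) ^ 2) ^ M := by
  have : 0 ≤ P / M := div_nonneg hP (Nat.cast_nonneg M)
  refine (hsel.minimal K G k).trans ((feedback1_le_norm_sub hP _ _).trans ?_)
  gcongr
  exact norm_sub_le_of_mem_closedBall hk.2 hk.1

theorem IsOIA2Selection.feedback1_le (hsel : IsOIA2Selection sel) (hP : 0 ≤ P)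
    (hE : Eᴴ * E = 1) (hδ : δ ≤ 1 / 2)
    (hinj : ∀ j, Function.Injective (G j).1.mulVec ∧ Function.Injective (G j).2.mulVec)
    (hk : G k ∈ Metric.closedBall E δ ×ˢ Metric.closedBall E δ) (hR : ∀ j, ‖(G j).2‖ ≤ R) :
    feedback1 P (G (sel K G)).1 (G (sel K G)).2 ≤
      (1 + P / M * (R ^ 2 * (4 * M * (2 * δ) ^ 2))) ^ M := by
  have : 0 ≤ P / M := div_nonneg hP (Nat.cast_nonneg M)
  choose T₁ hT₁ using fun j => exists_isGenerator (hinj j).1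
  choose T₂ hT₂ using fun j => exists_isGenerator (hinj j).2
  have hdist : chordalDistSq (T₁ (sel K G)) (T₂ (sel K G)) ≤ 4 * M * (2 * δ) ^ 2 := calc
    _ ≤ chordalDistSq (T₁ k) (T₂ k) :=
      hsel.minimal K G (fun j => (T₁ j, T₂ j)) (fun j => ⟨hT₁ j, hT₂ j⟩) k
    _ ≤ 4 * M * ‖(G k).1 - (G k).2‖ ^ 2 :=
      chordalDistSq_le_norm_sub hE (mem_closedBall_iff_norm.1 hk.1 |>.trans hδ) (hT₁ k) (hT₂ k)
    _ ≤ 4 * M * (2 * δ) ^ 2 := by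
      gcongr
      exact norm_sub_le_of_mem_closedBall hk.1 hk.2
  have hdist0 : 0 ≤ chordalDistSq (T₁ (sel K G)) (T₂ (sel K G)) := by
    rw [chordalDistSq_eq_norm_sq (hT₁ _).1 (hT₂ _).1]
    positivity
  refine (feedback1_le_chordalDistSq hP (hT₁ _) (hT₂ _)).trans ?_
  gcongr
  exact hR _

theorem feedback1_selected_le (hP : 0 ≤ P) (hsel : IsOIA1Selection P sel ∨ IsOIA2Selection sel)
    (hE : Eᴴ * E = 1) (hδ : δ ≤ 1 / 2) (hR1 : 1 ≤ R)
    (hinj : ∀ j, Function.Injective (G j).1.mulVec ∧ Function.Injective (G j).2.mulVec)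
    (hk : G k ∈ Metric.closedBall E δ ×ˢ Metric.closedBall E δ) (hR : ∀ j, ‖(G j).2‖ ≤ R) :
    feedback1 P (G (sel K G)).1 (G (sel K G)).2 ≤
      (1 + P / M * ((4 * M + 1) * (2 * (R * δ)) ^ 2)) ^ M := by
  have : 0 ≤ P / M := div_nonneg hP (Nat.cast_nonneg M)
  rcases hsel with hsel | hsel
  · refine (hsel.feedback1_le hP hk).trans ?_
    have hR2 : 1 ≤ R ^ 2 := one_le_pow₀ hR1
    gcongr
    calc (2 * δ) ^ 2 ≤ (4 * M + 1) * R ^ 2 * (2 * δ) ^ 2 :=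
          le_mul_of_one_le_left (sq_nonneg _)
            (one_le_mul_of_one_le_of_one_le (by linarith [Nat.cast_nonneg (α := ℝ) M]) hR2)
      _ = (4 * M + 1) * (2 * (R * δ)) ^ 2 := by ring
  · refine (hsel.feedback1_le hP hE hδ hinj hk hR).trans ?_
    refine pow_le_pow_left₀ (by positivity) ?_ M
    gcongr 1 + P / M * ?_
    calc R ^ 2 * (4 * M * (2 * δ) ^ 2) = 4 * M * (2 * (R * δ)) ^ 2 := by ring
      _ ≤ (4 * M + 1) * (2 * (R * δ)) ^ 2 := by gcongr; linarith

end Selection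

section Asymptotics

variable {M : ℕ} {P : ℝ}

/-- The law of the interfering channels of `K + 1` users. -/
noncomputable abbrev interferenceLaw (M K : ℕ) : Measure (Fin (K + 1) → Channel M × Channel M) :=
  Measure.pi fun _ => (matrixGaussian (2 * M) M).prod (matrixGaussian (2 * M) M)

/-- A scale `x` growing with the number `K + 1` of users such that, with high probability, no
channel is larger than `x` while the interfering channels of some user are `x⁻²`-close to a given
channel. The latter event has probability of order `x⁻²` to the power `8 M²`, the real dimension of
a pair of channels, for each user, which dictates the exponent. -/
noncomputable def userScale (M K : ℕ) : ℝ :=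
  ((K : ℝ) + 1) ^ (((16 * M ^ 2 + 1 : ℕ) : ℝ)⁻¹)

theorem userScale_pow (M K : ℕ) : userScale M K ^ (16 * M ^ 2 + 1) = K + 1 :=
  Real.rpow_inv_natCast_pow (by positivity) (by positivity)

theorem one_le_userScale (M K : ℕ) : 1 ≤ userScale M K :=
  Real.one_le_rpow (by linarith [Nat.cast_nonneg (α := ℝ) K]) (by positivity)

theorem tendsto_userScale_atTop (M : ℕ) : Tendsto (userScale M) atTop atTop :=
  (tendsto_rpow_atTop (by positivity)).comp
    (tendsto_atTop_add_const_right _ _ tendsto_natCast_atTop_atTop)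

theorem measurableSet_closedBall_matrix {m n : ℕ} (E : Matrix (Fin m) (Fin n) ℂ) (δ : ℝ) :
    MeasurableSet (Metric.closedBall E δ) := by
  have hball : Metric.closedBall E δ = (fun X => X - E) ⁻¹' {X | ‖X‖ ≤ δ} := by
    ext X
    exact mem_closedBall_iff_norm
  rw [hball]
  exact (Continuous.measurable (by fun_prop)) (measurableSet_le measurable_norm_matrix
    measurable_const)

theorem tendsto_interferenceLaw_forall_notMem_closedBall (E : Channel M) :
    Tendsto (fun K => (interferenceLaw M K).real {G | ∀ k, G k ∉
      Metric.closedBall E (userScale M K ^ 2)⁻¹ ×ˢ Metric.closedBall E (userScale M K ^ 2)⁻¹})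
      atTop (𝓝 0) := by
  obtain ⟨κ, hκ, hball⟩ := exists_mul_pow_le_matrixGaussian_closedBall E
  have hlim : Tendsto (fun K => Real.exp (-(κ ^ 2 * userScale M K))) atTop (𝓝 0) :=
    Real.tendsto_exp_neg_atTop_nhds_zero.comp
      ((tendsto_userScale_atTop M).const_mul_atTop (by positivity))
  refine squeeze_zero (fun _ => measureReal_nonneg) (fun K => ?_) hlim
  have hx := one_le_userScale M K
  have hmeas := measurableSet_closedBall_matrix E (userScale M K ^ 2)⁻¹
  refine (pi_real_forall_notMem_le (hmeas.prod hmeas) (K + 1)).trans ?_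
  have hδ := hball (userScale M K ^ 2)⁻¹ (by positivity) (inv_le_one_of_one_le₀ (one_le_pow₀ hx))
  rw [Real.exp_le_exp, neg_le_neg_iff, measureReal_prod_prod, Nat.cast_succ, ← userScale_pow M K,
    ← sq]
  calc κ ^ 2 * userScale M K = userScale M K ^ (16 * M ^ 2 + 1) *
        (κ * (userScale M K ^ 2)⁻¹ ^ (2 * (2 * M * M))) ^ 2 := by
        have hx0 : userScale M K ≠ 0 := by positivity
        rw [inv_pow, ← pow_mul, mul_pow, inv_pow, ← pow_mul,
          show 2 * (2 * (2 * M * M)) * 2 = 16 * M ^ 2 by ring, pow_succ _ (16 * M ^ 2)]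
        field_simp
    _ ≤ _ := by gcongr

theorem tendsto_interferenceLaw_exists_userScale_le_norm (M : ℕ) :
    Tendsto (fun K => (interferenceLaw M K).real {G | ∃ k, userScale M K ≤ ‖(G k).2‖})
      atTop (𝓝 0) := by
  obtain ⟨C, hC⟩ := exists_matrixGaussian_norm_ge_le (2 * M) M (16 * M ^ 2 + 2)
  refine squeeze_zero (fun _ => measureReal_nonneg) (fun K => ?_)
    ((tendsto_userScale_atTop M).const_div_atTop C)
  have hx : 0 < userScale M K := zero_lt_one.trans_le (one_le_userScale M K)
  have hmeas : MeasurableSet {X : Channel M | userScale M K ≤ ‖X‖} :=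
    measurableSet_le measurable_const measurable_norm_matrix
  have htail : ((matrixGaussian (2 * M) M).prod (matrixGaussian (2 * M) M)).real
      (Prod.snd ⁻¹' {X | userScale M K ≤ ‖X‖}) ≤ C / userScale M K ^ (16 * M ^ 2 + 2) :=
    (measurePreserving_snd.measureReal_preimage hmeas.nullMeasurableSet).trans_le (hC _ hx)
  refine (pi_real_exists_mem_le (measurable_snd hmeas) (K + 1)).trans ?_
  calc ((K + 1 : ℕ) : ℝ) * _ ≤ ((K + 1 : ℕ) : ℝ) * (C / userScale M K ^ (16 * M ^ 2 + 2)) := by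
        gcongr
    _ = C / userScale M K := by
        rw [Nat.cast_succ, ← userScale_pow M K, pow_succ _ (16 * M ^ 2 + 1)]
        field_simp

theorem ae_interferenceLaw_injective_mulVec (M K : ℕ) : ∀ᵐ G ∂interferenceLaw M K,
    ∀ k, Function.Injective (G k).1.mulVec ∧ Function.Injective (G k).2.mulVec := by
  have hinj := ae_matrixGaussian_injective_mulVec (m := 2 * M) (n := M) (by omega)
  have hpair : ∀ᵐ p : Channel M × Channel M
      ∂(matrixGaussian (2 * M) M).prod (matrixGaussian (2 * M) M),
      Function.Injective p.1.mulVec ∧ Function.Injective p.2.mulVec := by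
    filter_upwards [measurePreserving_fst.quasiMeasurePreserving.ae hinj,
      measurePreserving_snd.quasiMeasurePreserving.ae hinj] with p h₁ h₂ using ⟨h₁, h₂⟩
  exact ae_all_iff.2 fun k => (measurePreserving_eval (fun _ : Fin (K + 1) =>
    (matrixGaussian (2 * M) M).prod (matrixGaussian (2 * M) M)) k).quasiMeasurePreserving.ae hpair

theorem tendsto_interferenceLaw_lt_feedback1_selected (hP : 0 ≤ P) {sel : Selection M}
    (hsel : IsOIA1Selection P sel ∨ IsOIA2Selection sel) {b : ℝ} (hb : 1 < b) :
    Tendsto (fun K => (interferenceLaw M K).real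
      {G | b < feedback1 P (G (sel K G)).1 (G (sel K G)).2}) atTop (𝓝 0) := by
  obtain ⟨E, hE⟩ := exists_conjTranspose_mul_self_eq_one (m := 2 * M) (n := M) (by omega)
  have hx := tendsto_userScale_atTop M
  have hδ : Tendsto (fun K => (userScale M K ^ 2)⁻¹) atTop (𝓝 0) :=
    ((tendsto_pow_atTop two_ne_zero).comp hx).inv_tendsto_atTop
  have hbound : Tendsto (fun K => (1 + P / M * ((4 * M + 1) *
      (2 * (userScale M K * (userScale M K ^ 2)⁻¹)) ^ 2)) ^ M) atTop (𝓝 1) := by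
    have hcancel (x : ℝ) : x * (x ^ 2)⁻¹ = x⁻¹ := by
      simpa only [sq, mul_inv, mul_comm, inv_inv] using mul_self_mul_inv x⁻¹
    have hsq := ((hx.inv_tendsto_atTop.const_mul 2).pow 2).const_mul (4 * M + 1 : ℝ)
    simpa [hcancel] using ((hsq.const_mul (P / M)).const_add 1).pow M
  have hsum := (tendsto_interferenceLaw_forall_notMem_closedBall E).add
    (tendsto_interferenceLaw_exists_userScale_le_norm M)
  rw [add_zero] at hsum
  refine squeeze_zero' (.of_forall fun _ => measureReal_nonneg) ?_ hsum
  filter_upwards [hδ.eventually_le_const (by norm_num : (0 : ℝ) < 1 / 2),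
    hbound.eventually_lt_const hb] with K hδK hbK
  refine (ENNReal.toReal_mono (by finiteness) (measure_mono_ae ?_)).trans
    (measureReal_union_le _ _)
  filter_upwards [ae_interferenceLaw_injective_mulVec M K] with G hinj hG
  by_contra hgood
  obtain ⟨hnear, hnorm⟩ := not_or.1 hgood
  obtain ⟨k, hk⟩ := not_forall_not.1 hnear
  have hR (j : Fin (K + 1)) : ‖(G j).2‖ ≤ userScale M K := (not_le.1 fun h => hnorm ⟨j, h⟩).le
  exact (hbK.trans hG).not_ge
    (feedback1_selected_le hP hsel hE hδK (one_le_userScale M K) hinj hk hR)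

end Asymptotics

section ChannelLaw

/-- The interfering channels of `K + 1` users and their desired channels, in the form in which the
selection rule and the rates read them. -/
abbrev UserChannels (M K : ℕ) :=
  (Fin (K + 1) → Channel M × Channel M) × (Fin (K + 1) → Channel M)

/-- The joint law of the channels of `K + 1` users. -/
noncomputable abbrev channelLaw (M K : ℕ) : Measure (UserChannels M K) :=
  (interferenceLaw M K).prod (Measure.pi fun _ => matrixGaussian (2 * M) M)

/-- Lists the entries of the channels of `K + 1` users as one family, indexed as in
`IsGaussianChannel`. -/
def channelEntries (M K : ℕ) :
    UserChannels M K ≃ᵐ (Fin (K + 1) × Fin 3 × Fin (2 * M) × Fin M → ℂ) where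
  toFun Z j := ![Z.2 j.1, (Z.1 j.1).1, (Z.1 j.1).2] j.2.1 j.2.2.1 j.2.2.2
  invFun z := (fun k => (fun r c => z (k, 1, r, c), fun r c => z (k, 2, r, c)),
    fun k r c => z (k, 0, r, c))
  left_inv _ := rfl
  right_inv z := by
    ext ⟨k, i, r, c⟩
    fin_cases i <;> rfl
  measurable_toFun := by
    refine measurable_pi_lambda _ fun ⟨k, i, r, c⟩ =>
      (measurePreserving_entry r c).measurable.comp ?_
    fin_cases i
    · exact (measurable_pi_apply k).comp measurable_snd
    · exact measurable_fst.comp ((measurable_pi_apply k).comp measurable_fst)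
    · exact measurable_snd.comp ((measurable_pi_apply k).comp measurable_fst)
  measurable_invFun := by
    have hmatrix (k : Fin (K + 1)) (i : Fin 3) :
        Measurable fun (z : Fin (K + 1) × Fin 3 × Fin (2 * M) × Fin M → ℂ) =>
          (fun r c => z (k, i, r, c) : Channel M) :=
      measurable_pi_lambda _ fun r => measurable_pi_lambda _ fun c => measurable_pi_apply _
    exact (measurable_pi_lambda _ fun k => (hmatrix k 1).prodMk (hmatrix k 2)).prodMk
      (measurable_pi_lambda _ fun k => hmatrix k 0)

theorem measurePreserving_channelEntries (M K : ℕ) :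
    MeasurePreserving (channelEntries M K) (channelLaw M K)
      (Measure.pi fun _ => complexGaussian) := by
  refine ⟨(channelEntries M K).measurable, (Measure.pi_eq fun s _ => ?_).symm⟩
  let S (k : Fin (K + 1)) (i : Fin 3) : Set (Channel M) := {X | ∀ r c, X r c ∈ s (k, i, r, c)}
  have hbox : channelEntries M K ⁻¹' Set.univ.pi s =
      (Set.univ.pi fun k => S k 1 ×ˢ S k 2) ×ˢ (Set.univ.pi fun k => S k 0) := by
    ext Z
    simp only [S, Set.mem_preimage, Set.mem_univ_pi, Set.mem_prod, Set.mem_ofPred_eq, Prod.forall]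
    constructor
    · exact fun h => ⟨fun k => ⟨h k 1, h k 2⟩, fun k => h k 0⟩
    · rintro ⟨hAB, hD⟩ k i
      fin_cases i
      exacts [hD k, (hAB k).1, (hAB k).2]
  rw [(channelEntries M K).map_apply, hbox, Measure.prod_prod, Measure.pi_pi, Measure.pi_pi]
  simp_rw [Measure.prod_prod, S, matrixGaussian_forall_entry_mem, Fintype.prod_prod_type,
    Fin.prod_univ_three, Finset.prod_mul_distrib]
  ring

end ChannelLaw

theorem IsGaussianChannel.hasLaw_channels {Ω : Type*} [MeasurableSpace Ω] {μ : Measure Ω} {M : ℕ}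
    {H : ℕ → Fin 3 → Ω → Channel M} (hH : IsGaussianChannel μ H) (K : ℕ) :
    HasLaw (fun ω => (fun k : Fin (K + 1) => (H k 1 ω, H k 2 ω), fun k : Fin (K + 1) => H k 0 ω))
      (channelLaw M K) μ := by
  have hinj : Function.Injective (Prod.map Fin.val id :
      Fin (K + 1) × Fin 3 × Fin (2 * M) × Fin M → ℕ × Fin 3 × Fin (2 * M) × Fin M) :=
    Fin.val_injective.prodMap Function.injective_id
  have hentries := iIndepFun.hasLaw_pi (μ := fun _ => complexGaussian)
    (fun _ => hH.hasLaw _ _ _ _) (hH.indep.precomp hinj)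
  exact ((measurePreserving_channelEntries M K).symm).comp_hasLaw hentries

section Decoupling

variable {Y : Type*} [MeasurableSpace Y] {N m n p : ℕ}

theorem measurable_apply_index {Z β : Type*} [MeasurableSpace Z] [MeasurableSpace β]
    {κ : Z → Fin N} (hκ : Measurable κ) {f : Fin N → Z → β} (hf : ∀ k, Measurable (f k)) :
    Measurable fun z => f (κ z) z :=
  (measurable_from_prod_countable_right (f := fun p : Fin N × Z => f p.1 p.2) hf).comp
    (hκ.prodMk measurable_id)

/- A Gaussian matrix multiplied by an independent matrix with orthonormal rows is Gaussian and
independent of the latter, because its conditional law does not depend on it. -/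
theorem measurePreserving_mul_apply_index (ν : Measure Y) [SFinite ν] {κ : Y → Fin N}
    (hκ : Measurable κ) {U : Y → Matrix (Fin p) (Fin m) ℂ} (hU : Measurable U)
    (hUU : ∀ y, U y * (U y)ᴴ = 1) :
    MeasurePreserving
      (fun Z : Y × (Fin N → Matrix (Fin m) (Fin n) ℂ) => (Z.1, U Z.1 * Z.2 (κ Z.1)))
      (ν.prod (Measure.pi fun _ => matrixGaussian m n)) (ν.prod (matrixGaussian p n)) := by
  refine (MeasurePreserving.id ν).skew_product
    (g := fun y (D : Fin N → Matrix (Fin m) (Fin n) ℂ) => U y * D (κ y)) ?_ (.of_forall fun y => ?_)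
  · have hmul : Measurable fun q : Matrix (Fin p) (Fin m) ℂ × Matrix (Fin m) (Fin n) ℂ =>
        q.1 * q.2 := Continuous.measurable (by fun_prop)
    exact hmul.comp ((hU.comp measurable_fst).prodMk
      (measurable_apply_index (hκ.comp measurable_fst)
        (f := fun k (Z : Y × (Fin N → Matrix (Fin m) (Fin n) ℂ)) => Z.2 k)
        fun k => (measurable_pi_apply k).comp measurable_snd))
  · have hmul : Measurable fun X : Matrix (Fin m) (Fin n) ℂ => U y * X :=
      Continuous.measurable (by fun_prop)
    have heval := measurePreserving_eval (fun _ : Fin N => matrixGaussian m n) (κ y)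
    have hmap : MeasurePreserving (fun X => U y * X) (matrixGaussian m n) (matrixGaussian p n) :=
      ⟨hmul, map_mul_matrixGaussian (hUU y)⟩
    exact (hmap.comp heval).map_eq

end Decoupling

section ProductConvergence

variable {X : Type*} [MeasurableSpace X] {γ : Measure X} [IsProbabilityMeasure γ] {f : X → ℝ}

theorem integral_sub_integral_prod_le {Y : Type*} [MeasurableSpace Y] {ν : Measure Y}
    [IsProbabilityMeasure ν] (hf : Integrable f γ) {g : Y × X → ℝ}
    (hg : Integrable g (ν.prod γ)) (hg0 : 0 ≤ g) {L : Y → ℝ} (hL : Measurable L)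
    (hfg : ∀ z, f z.2 - L z.1 ≤ g z) {ε : ℝ} (hε : 0 ≤ ε) :
    ∫ x, f x ∂γ - ∫ z, g z ∂ν.prod γ ≤ ε + ν.real {y | ε < L y} * ∫ x, f x ∂γ := by
  have hE : MeasurableSet {y | ε < L y} := measurableSet_lt measurable_const hL
  have hfE := Integrable.mul_prod (f := {y | ε < L y}.indicator 1)
    ((integrable_const (1 : ℝ)).indicator hE (μ := ν)) hf
  have hle (z : Y × X) : f z.2 - g z ≤ ε + {y | ε < L y}.indicator 1 z.1 * f z.2 := by
    by_cases hz : ε < L z.1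
    · rw [Set.indicator_of_mem (by exact hz), Pi.one_apply, one_mul]
      linarith [show 0 ≤ g z from hg0 z]
    · rw [Set.indicator_of_notMem (by exact hz), zero_mul]
      linarith [hfg z, not_lt.1 hz]
  calc ∫ x, f x ∂γ - ∫ z, g z ∂ν.prod γ = ∫ z, (f z.2 - g z) ∂ν.prod γ := by
        rw [integral_sub (hf.comp_snd ν) hg, integral_fun_snd, probReal_univ, one_smul]
    _ ≤ ∫ z, (ε + {y | ε < L y}.indicator 1 z.1 * f z.2) ∂ν.prod γ :=
        integral_mono ((hf.comp_snd ν).sub hg) ((integrable_const ε).add hfE) hle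
    _ = ε + ν.real {y | ε < L y} * ∫ x, f x ∂γ := by
        rw [integral_add (integrable_const ε) hfE, integral_prod_mul, integral_indicator_one hE,
          integral_const, probReal_univ, one_smul]

theorem tendsto_integral_prod {Y : ℕ → Type*} [∀ K, MeasurableSpace (Y K)]
    {ν : ∀ K, Measure (Y K)} [∀ K, IsProbabilityMeasure (ν K)] (hf : Integrable f γ)
    {g : ∀ K, Y K × X → ℝ} (hg : ∀ K, Integrable (g K) ((ν K).prod γ)) (hg0 : ∀ K, 0 ≤ g K)
    (hgf : ∀ K z, g K z ≤ f z.2) {L : ∀ K, Y K → ℝ} (hL : ∀ K, Measurable (L K))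
    (hfg : ∀ K z, f z.2 - L K z.1 ≤ g K z)
    (hlim : ∀ ε > 0, Tendsto (fun K => (ν K).real {y | ε < L K y}) atTop (𝓝 0)) :
    Tendsto (fun K => ∫ z, g K z ∂(ν K).prod γ) atTop (𝓝 (∫ x, f x ∂γ)) := by
  have hupper (K : ℕ) : ∫ z, g K z ∂(ν K).prod γ ≤ ∫ x, f x ∂γ :=
    (integral_mono (hg K) (hf.comp_snd (ν K)) (hgf K)).trans_eq
      (by rw [integral_fun_snd, probReal_univ, one_smul])
  refine tendsto_order.2 ⟨fun a ha => ?_, fun a ha => .of_forall fun K => (hupper K).trans_lt ha⟩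
  obtain ⟨ε, hε, haε⟩ := exists_between (sub_pos.2 ha)
  have hbound := ((hlim ε hε).mul_const (∫ x, f x ∂γ)).const_add ε
  rw [zero_mul, add_zero] at hbound
  filter_upwards [hbound.eventually_lt_const haε] with K hK
  linarith [integral_sub_integral_prod_le hf (hg K) (hg0 K) (hL K) (hfg K) hε.le]

end ProductConvergence

section EffectiveRate

variable {M : ℕ} {P : ℝ}

theorem measurable_effectiveRate (M : ℕ) (P : ℝ) :
    Measurable fun z : Matrix (Fin M) (Fin M) ℂ × Matrix (Fin M) (Fin M) ℂ =>
      effectiveRate P z.1 z.2 := by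
  have hadd : Measurable fun z : Matrix (Fin M) (Fin M) ℂ × Matrix (Fin M) (Fin M) ℂ =>
      z.1 + z.2 := Continuous.measurable (by fun_prop)
  exact (measurable_logDet.comp (hadd.comp (measurable_fst.prodMk
    ((measurable_signalCov M P).comp measurable_snd)))).sub (measurable_logDet.comp measurable_fst)

theorem integrable_effectiveRate {Y : Type*} [MeasurableSpace Y] {ν : Measure Y}
    [IsProbabilityMeasure ν] (hP : 0 ≤ P) {S : Y → Matrix (Fin M) (Fin M) ℂ} (hS : Measurable S)
    (hS0 : ∀ y, (S y).PosSemidef) :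
    Integrable (fun z => effectiveRate P (S z.1) z.2) (ν.prod (matrixGaussian M M)) := by
  refine ((integrable_pointToPointRate hP).comp_snd ν).mono'
    ((measurable_effectiveRate M P).comp
      ((hS.comp measurable_fst).prodMk measurable_snd)).aestronglyMeasurable
    (.of_forall fun z => ?_)
  rw [Real.norm_of_nonneg (effectiveRate_nonneg hP (hS0 _) _)]
  exact effectiveRate_le_pointToPointRate hP (hS0 _) _

theorem tendsto_integral_effectiveRate {Y : ℕ → Type*} [∀ K, MeasurableSpace (Y K)]
    {ν : ∀ K, Measure (Y K)} [∀ K, IsProbabilityMeasure (ν K)] (hP : 0 ≤ P)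
    {S : ∀ K, Y K → Matrix (Fin M) (Fin M) ℂ} (hS : ∀ K, Measurable (S K))
    (hS0 : ∀ K y, (S K y).PosSemidef)
    (hlim : ∀ ε > 0, Tendsto (fun K => (ν K).real {y | ε < logDet (S K y)}) atTop (𝓝 0)) :
    Tendsto (fun K => ∫ z, effectiveRate P (S K z.1) z.2 ∂(ν K).prod (matrixGaussian M M)) atTop
      (𝓝 (ergodicCapacity M P)) :=
  tendsto_integral_prod (integrable_pointToPointRate hP)
    (fun K => integrable_effectiveRate hP (hS K) (hS0 K))
    (fun K z => effectiveRate_nonneg hP (hS0 K z.1) z.2)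
    (fun K z => effectiveRate_le_pointToPointRate hP (hS0 K z.1) z.2)
    (fun K => measurable_logDet.comp (hS K))
    (fun K z => pointToPointRate_sub_logDet_le hP (hS0 K z.1) z.2) hlim

end EffectiveRate

section SelectedUser

variable {M : ℕ} {P : ℝ} {F : ℕ → Channel M → Channel M → Post M} {sel : Selection M} {K : ℕ}

/-- The postprocessing matrix of the selected user, as a function of the interfering channels. -/
def selectedPost (F : ℕ → Channel M → Channel M → Post M) (sel : Selection M) (K : ℕ)
    (G : Fin (K + 1) → Channel M × Channel M) : Post M :=
  F (sel K G) (G (sel K G)).1 (G (sel K G)).2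

/-- The covariance of the interference at the selected user after postprocessing, as a function of
the interfering channels. -/
noncomputable def selectedInterference (P : ℝ) (F : ℕ → Channel M → Channel M → Post M)
    (sel : Selection M) (K : ℕ) (G : Fin (K + 1) → Channel M × Channel M) :
    Matrix (Fin M) (Fin M) ℂ :=
  interference P (selectedPost F sel K G) (G (sel K G)).1 (G (sel K G)).2

theorem measurable_selectedPost (hF : IsOIAPostprocessing P F) (hsel : Measurable (sel K)) :
    Measurable (selectedPost F sel K) :=
  measurable_apply_index hsel
    (f := fun k (G : Fin (K + 1) → Channel M × Channel M) => F k (G k).1 (G k).2)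
    fun k => (hF.measurable k).comp (measurable_pi_apply k)

theorem measurable_interference {Z : Type*} [MeasurableSpace Z] {U : Z → Post M}
    {A B : Z → Channel M} (hU : Measurable U) (hA : Measurable A) (hB : Measurable B) (P : ℝ) :
    Measurable fun z => interference P (U z) (A z) (B z) := by
  have hcont : Continuous fun q : Post M × Channel M × Channel M =>
      interference P q.1 q.2.1 q.2.2 := by
    unfold interference signalCov
    fun_prop
  simpa only [Function.comp_def] using hcont.measurable.comp (hU.prodMk (hA.prodMk hB))

theorem measurable_selectedInterference (hF : IsOIAPostprocessing P F)
    (hsel : Measurable (sel K)) : Measurable (selectedInterference P F sel K) := by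
  have hchannels : Measurable fun G : Fin (K + 1) → Channel M × Channel M => G (sel K G) :=
    measurable_apply_index hsel (f := fun k (G : Fin (K + 1) → Channel M × Channel M) => G k)
      measurable_pi_apply
  exact measurable_interference (measurable_selectedPost hF hsel) hchannels.fst hchannels.snd P

theorem posSemidef_selectedInterference (hP : 0 ≤ P) (G : Fin (K + 1) → Channel M × Channel M) :
    (selectedInterference P F sel K G).PosSemidef :=
  posSemidef_interference hP _ _ _

theorem tendsto_interferenceLaw_lt_logDet_selectedInterference (hP : 0 ≤ P)
    (hF : IsOIAPostprocessing P F) (hsel : IsOIA1Selection P sel ∨ IsOIA2Selection sel) {ε : ℝ}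
    (hε : 0 < ε) :
    Tendsto (fun K => (interferenceLaw M K).real
      {G | ε < logDet (selectedInterference P F sel K G)}) atTop (𝓝 0) := by
  refine squeeze_zero (fun _ => measureReal_nonneg) (fun K => measureReal_mono fun G hG => ?_)
    (tendsto_interferenceLaw_lt_feedback1_selected hP hsel (Real.one_lt_rpow one_lt_two hε))
  have hfeedback : ε < Real.logb 2 (feedback1 P (G (sel K G)).1 (G (sel K G)).2) :=
    hG.trans_le ((rateLoss_eq _ _ _).ge.trans (hF.rateLoss_le _ _ _))
  have hpos := zero_lt_one.trans_le (one_le_feedback1 (G (sel K G)).1 (G (sel K G)).2 hP)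
  exact (Real.lt_logb_iff_rpow_lt one_lt_two hpos).1 hfeedback

variable {Ω : Type*} {H : ℕ → Fin 3 → Ω → Channel M}

/-- The interfering channels of all `K + 1` users, together with the desired channel of the
selected user after postprocessing. -/
def selectedChannels (H : ℕ → Fin 3 → Ω → Channel M) (F : ℕ → Channel M → Channel M → Post M)
    (sel : Selection M) (K : ℕ) (ω : Ω) :
    (Fin (K + 1) → Channel M × Channel M) × Matrix (Fin M) (Fin M) ℂ :=
  let G : Fin (K + 1) → Channel M × Channel M := fun k => (H k 1 ω, H k 2 ω)
  (G, selectedPost F sel K G * H (sel K G) 0 ω)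

theorem selectedRate_eq_effectiveRate (hP : 0 ≤ P) (ω : Ω) :
    selectedRate P H F sel K ω =
      effectiveRate P (selectedInterference P F sel K (selectedChannels H F sel K ω).1)
        (selectedChannels H F sel K ω).2 :=
  rate_eq_effectiveRate hP _ _ _ _

theorem hasLaw_selectedChannels [MeasurableSpace Ω] {μ : Measure Ω} (hH : IsGaussianChannel μ H)
    (hF : IsOIAPostprocessing P F) (hsel : Measurable (sel K)) :
    HasLaw (selectedChannels H F sel K) ((interferenceLaw M K).prod (matrixGaussian M M)) μ :=
  (measurePreserving_mul_apply_index _ hsel (measurable_selectedPost hF hsel)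
    fun _ => hF.semiUnitary _ _ _).comp_hasLaw (hH.hasLaw_channels K)

end SelectedUser

end OIA

theorem theorem1 {Ω : Type*} [MeasurableSpace Ω] (μ : Measure Ω) [IsProbabilityMeasure μ]
    (M : ℕ) (hM : 0 < M) (P : ℝ) (hP : 0 < P)
    (H : ℕ → Fin 3 → Ω → OIA.Channel M) (hH : OIA.IsGaussianChannel μ H)
    (F : ℕ → OIA.Channel M → OIA.Channel M → OIA.Post M) (hF : OIA.IsOIAPostprocessing P F)
    (sel : OIA.Selection M) (hsel : OIA.IsOIA1Selection P sel ∨ OIA.IsOIA2Selection sel) :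
    Integrable (fun G => OIA.pointToPointRate P (Matrix.of G)) (OIA.gaussianMatrix M) ∧
    (∀ K, Integrable (OIA.selectedRate P H F sel K) μ) ∧
    Tendsto (fun K => ∫ ω, OIA.selectedRate P H F sel K ω ∂μ) atTop
      (𝓝 (OIA.ergodicCapacity M P)) := by
  have hmeas : ∀ K, Measurable (sel K) := hsel.elim (·.measurable) (·.measurable)
  have hS (K : ℕ) := OIA.measurable_selectedInterference hF (hmeas K)
  have hS0 (K : ℕ) := OIA.posSemidef_selectedInterference (F := F) (sel := sel) (K := K) hP.le
  have hlaw (K : ℕ) := OIA.hasLaw_selectedChannels hH hF (hmeas K)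
  have hint (K : ℕ) :=
    OIA.integrable_effectiveRate (ν := OIA.interferenceLaw M K) hP.le (hS K) (hS0 K)
  have hrate (K : ℕ) : OIA.selectedRate P H F sel K =
      (fun z => OIA.effectiveRate P (OIA.selectedInterference P F sel K z.1) z.2) ∘
        OIA.selectedChannels H F sel K :=
    funext fun ω => OIA.selectedRate_eq_effectiveRate hP.le ω
  refine ⟨OIA.integrable_pointToPointRate hP.le, fun K => ?_, ?_⟩
  · rw [hrate K]
    exact ((hlaw K).map_eq ▸ hint K).comp_aemeasurable (hlaw K).aemeasurable
  · refine (OIA.tendsto_integral_effectiveRate hP.le hS hS0 fun ε hε =>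
      OIA.tendsto_interferenceLaw_lt_logDet_selectedInterference hP.le hF hsel hε).congr fun K => ?_
    rw [hrate K]
    exact ((hlaw K).integral_comp (hint K).aestronglyMeasurable).symm
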